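/- Let $V\subset\mathbb{C}$ be a simply connected domain with coordinate $z=x+iy$ and let $\rho$ be holomorphic on $V$. Write $\partial_z=\frac12(\partial_x-i\partial_y)$, $\partial_{\bar z}=\frac12(\partial_x+i\partial_y)$. Consider pairs $w=(w_1,w_2)$ of holomorphic functions on $V$ with $$w_i''+\tfrac{\rho}{4}w_i=0\quad(i=1,2),\qquad w_1w_2'-w_2w_1'=\tfrac12,\tag{1}$$ and put $|w|^2=|w_1|^2+|w_2|^2$, $u_w=\log|w|^2$. (a) A function $u:V\to\mathbb{R}$ is a $C^\infty$ solution of $$4\,\partial_z\partial_{\bar z}u=e^{-2u},\qquad \partial_z^2u+(\partial_zu)^2=-\tfrac{\rho}{4}\tag{2}$$ if and only if $u=u_w$ for some pair $w$ satisfying (1). (b) Pairs satisfying (1) exist. For each such pair $w$ the map $B\,\mathrm{SU}(2)\mapsto u_{B^{-1}w}$ is a well-defined bijection from $\mathrm{SL}(2,\mathbb{C})/\mathrm{SU}(2)$ onto the set of all $C^\infty$ real solutions of (2). This solution space is three-dimensional: for every $z_0\in V$ the map $B\,\mathrm{SU}(2)\mapsto\big(u_{B^{-1}w}(z_0),\,\partial_zu_{B^{-1}w}(z_0)\big)$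 is a homeomorphism from $\mathrm{SL}(2,\mathbb{C})/\mathrm{SU}(2)$ onto $\mathbb{R}\times\mathbb{C}$. (c) For every pair $w$ satisfying (1) there is a smooth minimal immersion $X:V\to\mathbb{R}^3$ with first fundamental form $g=|w|^4\,|dz|^2$, second fundamental form $A=\operatorname{Re}(dz^2)$ (with respect to the unit normal $X_x\times X_y/|X_x\times X_y|$), hence Hopf differential $dz^2$, with Gauss curvature $K_g<0$ on $V$, and with entropy differential $P=\frac{\rho}{2}\,dz^2$. Here, on an oriented surface with metric $g$ and associated complex structure $J$, the quadratic differential with real part a symmetric trace-free $2$-form $h$ is $h-i\,h(J\cdot,\cdot)$. The Hopf differential of a minimal immersion is the quadratic differential with real part $A$. If $K_g<0$, the entropy differential $P$ of $g$ is the quadratic differential with real part the entropy form $T$, where $T$ is the trace-free part of the Hessian of $\log K_{\hat g}$, both taken with respect to $\hat g=|K_g|^{3/4}g$. -/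

import Mathlib

open Complex Matrix
open scoped ContDiff MatrixGroups

/-! ### Wirtinger derivatives and the system for `u` -/

/-- The operator `∂/∂z = (∂/∂x - i ∂/∂y) / 2`. -/
noncomputable def wirtingerZ (f : ℂ → ℂ) (p : ℂ) : ℂ :=
  (fderiv ℝ f p 1 - I * fderiv ℝ f p I) / 2

/-- The operator `∂/∂z̄ = (∂/∂x + i ∂/∂y) / 2`. -/
noncomputable def wirtingerZbar (f : ℂ → ℂ) (p : ℂ) : ℂ :=
  (fderiv ℝ f p 1 + I * fderiv ℝ f p I) / 2

/-- `u` is a real solution of class `C^∞` on `V` of the system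
`4 u_{z z̄} = e^{-2u}`, `u_{zz} + (u_z)² = -ρ/4`. Only the values of `u` on `V` matter when `V`
is open. -/
structure IsLiouvilleSolution (V : Set ℂ) (ρ : ℂ → ℂ) (u : ℂ → ℝ) : Prop where
  smooth : ContDiffOn ℝ ∞ u V
  liouville : ∀ z ∈ V,
    4 * wirtingerZ (wirtingerZbar fun p => (u p : ℂ)) z = ((Real.exp (-2 * u z) : ℝ) : ℂ)
  schwarzian : ∀ z ∈ V,
    wirtingerZ (wirtingerZ fun p => (u p : ℂ)) z + (wirtingerZ (fun p => (u p : ℂ)) z) ^ 2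
      = -ρ z / 4

/-- The set of all solutions, as functions on `V`. -/
def liouvilleSolutions (V : Set ℂ) (ρ : ℂ → ℂ) : Set (V → ℝ) :=
  {f | ∃ u : ℂ → ℝ, IsLiouvilleSolution V ρ u ∧ ∀ z : V, f z = u z}

/-! ### Hill's equation -/

/-- `w = (w₁, w₂)` is a pair of holomorphic solutions on `V` of `w'' + (ρ/4) w = 0` with
Wronskian `w₁ w₂' - w₂ w₁' = 1/2`. -/
structure IsHillPair (V : Set ℂ) (ρ : ℂ → ℂ) (w : ℂ → Fin 2 → ℂ) : Prop where
  holomorphic : ∀ i, DifferentiableOn ℂ (fun z => w z i) V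
  ode : ∀ i, ∀ z ∈ V, deriv (deriv fun p => w p i) z + ρ z / 4 * w z i = 0
  wronskian : ∀ z ∈ V,
    w z 0 * deriv (fun p => w p 1) z - w z 1 * deriv (fun p => w p 0) z = 1 / 2

/-- `|w|² = |w₁|² + |w₂|²`. -/
noncomputable def hillNormSq (w : ℂ → Fin 2 → ℂ) (z : ℂ) : ℝ := ‖w z 0‖ ^ 2 + ‖w z 1‖ ^ 2

/-- `u_w = log |w|²`. -/
noncomputable def hillPotential (w : ℂ → Fin 2 → ℂ) (z : ℂ) : ℝ := Real.log (hillNormSq w z)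

/-- The pair `B w` for a matrix `B ∈ SL(2, ℂ)`. -/
def hillTransform (B : SL(2, ℂ)) (w : ℂ → Fin 2 → ℂ) (z : ℂ) : Fin 2 → ℂ :=
  (B : Matrix (Fin 2) (Fin 2) ℂ) *ᵥ w z

/-- `SU(2)` as a subgroup of `SL(2, ℂ)`. -/
def subgroupSU2 : Subgroup SL(2, ℂ) where
  carrier := {B | (B : Matrix (Fin 2) (Fin 2) ℂ) ∈ specialUnitaryGroup (Fin 2) ℂ}
  one_mem' := by
    simp
  mul_mem' := by
    intro a b ha hb
    simpa using (specialUnitaryGroup (Fin 2) ℂ).mul_mem ha hb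
  inv_mem' := by
    intro a ha
    have h1 : (a : Matrix (Fin 2) (Fin 2) ℂ) * star (a : Matrix (Fin 2) (Fin 2) ℂ) = 1 :=
      mem_unitaryGroup_iff.1 (mem_specialUnitaryGroup_iff.1 ha).1
    have h2 : ((a⁻¹ : SL(2, ℂ)) : Matrix (Fin 2) (Fin 2) ℂ) * (a : Matrix (Fin 2) (Fin 2) ℂ) = 1 :=
      congrArg Subtype.val (inv_mul_cancel a)
    have h3 : ((a⁻¹ : SL(2, ℂ)) : Matrix (Fin 2) (Fin 2) ℂ)
        = star (a : Matrix (Fin 2) (Fin 2) ℂ) := left_inv_eq_right_inv h2 h1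
    refine mem_specialUnitaryGroup_iff.2 ⟨?_, a⁻¹.2⟩
    rw [h3]
    exact Unitary.star_mem (mem_specialUnitaryGroup_iff.1 ha).1

/-! ### Riemannian geometry of surfaces in the chart `(x, y)` of `ℂ`

A covariant `2`-tensor field is given by its matrix of components with respect to the coordinate
vector fields `∂₀ = ∂/∂x`, `∂₁ = ∂/∂y`; the orientation is the standard one of `ℂ`. -/

/-- The coordinate vectors: `∂/∂x` is `1` and `∂/∂y` is `i`. The entries are also the values
`dz(∂/∂x)` and `dz(∂/∂y)`. -/
noncomputable def coordVec : Fin 2 → ℂ := ![1, I]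

/-- The partial derivative `∂ᵢ f`. -/
noncomputable def partialD {E : Type*} [NormedAddCommGroup E] [NormedSpace ℝ E]
    (i : Fin 2) (f : ℂ → E) (p : ℂ) : E :=
  fderiv ℝ f p (coordVec i)

/-- The quadratic differential `dz²`. -/
noncomputable def dzSq : Matrix (Fin 2) (Fin 2) ℂ :=
  of fun i j => coordVec i * coordVec j

/-- The flat metric `|dz|² = dz ∘ dz̄ = dx² + dy²`. -/
noncomputable def dzNormSq : Matrix (Fin 2) (Fin 2) ℝ :=
  of fun i j => (coordVec i * star (coordVec j)).re

/-- The Christoffel symbols `Γᵏᵢⱼ` of the metric `g`. -/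
noncomputable def christoffel (g : ℂ → Matrix (Fin 2) (Fin 2) ℝ) (k i j : Fin 2) (p : ℂ) : ℝ :=
  (1 / 2) * ∑ l, (g p)⁻¹ k l *
    (partialD i (fun q => g q j l) p + partialD j (fun q => g q i l) p
      - partialD l (fun q => g q i j) p)

/-- The components `Rˡ` of `R(∂ᵢ, ∂ⱼ)∂ₖ = ∇ᵢ∇ⱼ∂ₖ - ∇ⱼ∇ᵢ∂ₖ`. -/
noncomputable def riemannTensor (g : ℂ → Matrix (Fin 2) (Fin 2) ℝ) (i j k l : Fin 2) (p : ℂ) : ℝ :=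
  partialD i (christoffel g l j k) p - partialD j (christoffel g l i k) p
    + ∑ m, (christoffel g m j k p * christoffel g l i m p
      - christoffel g m i k p * christoffel g l j m p)

/-- The Gauss curvature `K_g = g(R(∂₀, ∂₁)∂₁, ∂₀) / det g`. -/
noncomputable def gaussCurvature (g : ℂ → Matrix (Fin 2) (Fin 2) ℝ) (p : ℂ) : ℝ :=
  (∑ l, g p 0 l * riemannTensor g 0 1 1 l p) / (g p).det

/-- The Hessian `∇²f` of a function with respect to the Levi-Civita connection of `g`. -/
noncomputable def hessian (g : ℂ → Matrix (Fin 2) (Fin 2) ℝ) (f : ℂ → ℝ) (p : ℂ) :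
    Matrix (Fin 2) (Fin 2) ℝ :=
  of fun i j => partialD i (partialD j f) p - ∑ k, christoffel g k i j p * partialD k f p

/-- The trace `tr_g h` of a symmetric `2`-tensor field. -/
noncomputable def metricTrace (g h : ℂ → Matrix (Fin 2) (Fin 2) ℝ) (p : ℂ) : ℝ :=
  ∑ i, ∑ j, (g p)⁻¹ i j * h p i j

/-- The trace-free part of a symmetric `2`-tensor field. -/
noncomputable def traceFreePart (g h : ℂ → Matrix (Fin 2) (Fin 2) ℝ) (p : ℂ) :
    Matrix (Fin 2) (Fin 2) ℝ :=
  h p - (metricTrace g h p / 2) • g p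

/-- The matrix of the rotation `J` by `+π/2` determined by `g` and the orientation:
`J ∂ⱼ = ∑ᵢ Jᵢⱼ ∂ᵢ`. -/
noncomputable def complexStructure (g : ℂ → Matrix (Fin 2) (Fin 2) ℝ) (p : ℂ) :
    Matrix (Fin 2) (Fin 2) ℝ :=
  (Real.sqrt (g p).det)⁻¹ • !![-(g p 0 1), -(g p 1 1); g p 0 0, g p 0 1]

/-- The quadratic differential (the complex bilinear form `Q` with `Q(J·,·) = i Q(·,·)`)
with real part the symmetric trace-free `2`-form `h`, that is `Q(X, Y) = h(X, Y) - i h(J X, Y)`. -/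
noncomputable def quadraticDifferential (g h : ℂ → Matrix (Fin 2) (Fin 2) ℝ) (p : ℂ) :
    Matrix (Fin 2) (Fin 2) ℂ :=
  of fun i j => (h p i j : ℂ) - I * ((∑ k, complexStructure g p k i * h p k j : ℝ) : ℂ)

/-- The metric `ĝ = |K_g|^{3/4} g`. -/
noncomputable def entropyMetric (g : ℂ → Matrix (Fin 2) (Fin 2) ℝ) (p : ℂ) :
    Matrix (Fin 2) (Fin 2) ℝ :=
  (|gaussCurvature g p| ^ (3 / 4 : ℝ)) • g p

/-- The entropy form `T` of `g`: the trace-free Hessian of `log K_ĝ` with respect to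
`ĝ = |K_g|^{3/4} g`. -/
noncomputable def entropyForm (g : ℂ → Matrix (Fin 2) (Fin 2) ℝ) :
    ℂ → Matrix (Fin 2) (Fin 2) ℝ :=
  traceFreePart (entropyMetric g)
    (hessian (entropyMetric g) fun q => Real.log (gaussCurvature (entropyMetric g) q))

/-- The entropy differential `P` of `g`: the quadratic differential with real part `T`. -/
noncomputable def entropyDifferential (g : ℂ → Matrix (Fin 2) (Fin 2) ℝ) :
    ℂ → Matrix (Fin 2) (Fin 2) ℂ :=
  quadraticDifferential g (entropyForm g)

/-! ### Immersed surfaces in `ℝ³` -/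

/-- The first fundamental form of `X`. -/
noncomputable def firstFundamentalForm (X : ℂ → EuclideanSpace ℝ (Fin 3)) (p : ℂ) :
    Matrix (Fin 2) (Fin 2) ℝ :=
  of fun i j => inner ℝ (partialD i X p) (partialD j X p)

/-- The orientation compatible Gauss map `∂₀X × ∂₁X / |∂₀X × ∂₁X|`. -/
noncomputable def gaussMap (X : ℂ → EuclideanSpace ℝ (Fin 3)) (p : ℂ) :
    EuclideanSpace ℝ (Fin 3) :=
  let ν : EuclideanSpace ℝ (Fin 3) :=
    WithLp.toLp 2 (crossProduct (WithLp.ofLp (partialD 0 X p)) (WithLp.ofLp (partialD 1 X p)))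
  ‖ν‖⁻¹ • ν

/-- The second fundamental form `Aᵢⱼ = ⟨∂ᵢ∂ⱼX, n⟩`. -/
noncomputable def secondFundamentalForm (X : ℂ → EuclideanSpace ℝ (Fin 3)) (p : ℂ) :
    Matrix (Fin 2) (Fin 2) ℝ :=
  of fun i j => inner ℝ (partialD i (partialD j X) p) (gaussMap X p)

/-- The mean curvature `H = tr_g A`. -/
noncomputable def meanCurvature (X : ℂ → EuclideanSpace ℝ (Fin 3)) (p : ℂ) : ℝ :=
  metricTrace (firstFundamentalForm X) (secondFundamentalForm X) p

/-- The Hopf differential of `X`: the quadratic differential with real part the second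
fundamental form. -/
noncomputable def hopfDifferential (X : ℂ → EuclideanSpace ℝ (Fin 3)) :
    ℂ → Matrix (Fin 2) (Fin 2) ℂ :=
  quadraticDifferential (firstFundamentalForm X) (secondFundamentalForm X)

/-- `X` restricts to a smooth minimal immersion of the open set `V`. -/
structure IsMinimalImmersion (V : Set ℂ) (X : ℂ → EuclideanSpace ℝ (Fin 3)) : Prop where
  smooth : ContDiffOn ℝ ∞ X V
  immersion : ∀ z ∈ V, Function.Injective (fderiv ℝ X z)
  minimal : ∀ z ∈ V, meanCurvature X z = 0

/-!
The argument rests on the existence of pairs `w` and on the rigidity of the system for `u`.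

*Existence.* A holomorphic function on a simply connected domain has a primitive: local primitives
differ by locally constant functions, so the graphs of all of them form a covering with discrete
fibres, and a global primitive is a lift of the identity
(`DifferentiableOn.isExactOn_of_isSimplyConnected`). With primitives at hand, linear equations
`Y' = A(z) Y` are solved by Picard iteration on the whole domain (`exists_hasDerivAt_linear`), which
gives pairs solving Hill's equation (`exists_isHillPair`).

*From pairs to solutions.* With `U = ∂u/∂z`, the system for `u` is the first order system
`∂U/∂z = -ρ/4 - U²`, `∂U/∂z̄ = e^{-2u}/4`. For `u = log |w|²` one has `U = ⟨w', w⟩ / |w|²`, and the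
second equation is the identity `|w|² |w'|² - |⟨w', w⟩|² = |w₁w₂' - w₂w₁'|² = 1/4`
(`IsHillPair.isLiouvilleSolution`).

*Rigidity.* A solution is determined by `u` and `∂u/∂z` at one point
(`IsLiouvilleSolution.eqOn_of_eq_at`): the function `φ = e^u` solves the linear equations
`φ_zz = -(ρ/4) φ`, `φ_z̄z̄ = -(ρ̄/4) φ`, and `φ_zz̄` is a function of `u` and `∂u/∂z`. On the other
hand, the values of `u_{B⁻¹w}` and its `z`-derivative at one point amount to the Gram matrix of
`B⁻¹ (w, w')` there, which determines `B` up to `SU(2)`; every pair of values in `ℝ × ℂ` is attained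
for a `B` that makes `B⁻¹ (w, w')` upper triangular at that point (`hillSection`). Hence
`SL(2, ℂ) / SU(2)` is homeomorphic to `ℝ × ℂ` (`IsHillPair.exists_homeomorph`), and each solution is
some `u_{B⁻¹w}` (`IsHillPair.exists_hillTransform`).

*Minimal surfaces.* The immersion is the real part of a primitive of the isotropic form
`(w₂² - w₁², -i(w₁² + w₂²), -2w₁w₂) dz` (`IsHillPair.exists_isMinimalImmersion`). Its metric is
`e^{2u} |dz|²` with `u = log |w|²`, and the curvature and entropy differential follow from the
formulas for conformal metrics together with the system for `u`
(`IsLiouvilleSolution.entropyDifferential_eq`).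
-/

/-! ### Primitives on simply connected domains -/

/-- Functions `F i` given on the members of an open cover of a simply connected space, with locally
constant differences, differ by locally constant functions from one global function `g`.
The graphs of all the functions `F i + const`, glued where they agree, form a covering of `X` with
discrete fibre `G`, and `g` is a lift of the identity. -/
theorem exists_glue_of_sub_locallyConstant {X G : Type*} [TopologicalSpace X]
    [SimplyConnectedSpace X] [LocallyPathConnectedSpace X] [AddCommGroup G]
    (U : X → Set X) (hU : ∀ i, IsOpen (U i)) (hmem : ∀ x, x ∈ U x) (F : X → X → G)
    (hF : ∀ i j, ∀ x ∈ U i ∩ U j, ∀ᶠ y in nhds x, F i y - F j y = F i x - F j x) :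
    ∃ g : X → G, ∀ i, ∀ x ∈ U i, ∀ᶠ y in nhds x, g y - F i y = g x - F i x := by
  let _ : TopologicalSpace G := ⊥
  have _ : DiscreteTopology G := ⟨rfl⟩
  let Z : FiberBundleCore X X G :=
    { baseSet := U
      isOpen_baseSet := hU
      indexAt := id
      mem_baseSet_at := hmem
      coordChange := fun i j x v => v + (F i x - F j x)
      coordChange_self := by intro i x _ v; simp
      continuousOn_coordChange := by
        intro i j p hp
        refine ContinuousAt.continuousWithinAt ?_
        have h1 : ContinuousAt (fun p : X × G => p.2 + (F i p.1 - F j p.1)) p := by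
          refine continuousAt_snd.add ?_
          refine ContinuousAt.comp (f := Prod.fst) (g := fun x => F i x - F j x) ?_ continuousAt_fst
          exact (tendsto_const_nhds).congr' ((hF i j p.1 hp.1).mono fun y hy => hy.symm)
        exact h1
      coordChange_comp := by intro i j k x _ v; abel }
  have hcov : IsCoveringMap (Z.proj : Z.TotalSpace → X) :=
    FiberBundle.isCoveringMap (F := G) (E := Z.Fiber)
  have x₀ : X := Classical.choice inferInstance
  obtain ⟨s, ⟨-, hs⟩, -⟩ := hcov.existsUnique_continuousMap_lifts (ContinuousMap.id X) x₀
    (⟨x₀, (0 : G)⟩ : Z.TotalSpace) rfl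
  have hs' : ∀ x, (s x).1 = x := fun x => congrFun hs x
  let g : X → G := fun x => (show G from (s x).2) + F (s x).1 x
  refine ⟨g, fun i x hx => ?_⟩
  have hc : ∀ y, ((Z.localTriv i) (s y)).2 = g y - F i y := by
    intro y
    rw [FiberBundleCore.localTriv_apply]
    change (show G from (s y).2) + (F (s y).1 (s y).1 - F i (s y).1) = _
    simp only [g, hs']
    abel
  have hcont : ContinuousAt (fun y => g y - F i y) x := by
    simp only [← hc]
    refine continuousAt_snd.comp (ContinuousAt.comp (f := s) ?_ s.continuous.continuousAt)
    refine (Z.localTriv i).continuousAt ?_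
    rw [FiberBundleCore.mem_localTriv_source]
    change (s x).1 ∈ U i
    rwa [hs']
  have := hcont.eventually_mem (show {g x - F i x} ∈ nhds (g x - F i x) by simp)
  simpa using this

/-- A holomorphic function on a simply connected domain has a primitive. -/
theorem DifferentiableOn.isExactOn_of_isSimplyConnected {E : Type*} [NormedAddCommGroup E]
    [NormedSpace ℂ E] [CompleteSpace E] {V : Set ℂ} (hVo : IsOpen V) (hVs : IsSimplyConnected V)
    {f : ℂ → E} (hf : DifferentiableOn ℂ f V) : IsExactOn f V := by
  have := hVs.simplyConnectedSpace
  have := hVo.locallyPathConnectedSpace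
  have hball : ∀ z : V, ∃ r > 0, Metric.ball (z : ℂ) r ⊆ V := fun z =>
    Metric.isOpen_iff.1 hVo z z.2
  choose r hr hrV using hball
  have hprim : ∀ z : V, ∃ F : ℂ → E, ∀ y ∈ Metric.ball (z : ℂ) (r z), HasDerivAt F (f y) y :=
    fun z => (hf.mono (hrV z)).isExactOn_ball
  choose F hF using hprim
  obtain ⟨g, hg⟩ := exists_glue_of_sub_locallyConstant
    (fun z : V => (Subtype.val ⁻¹' Metric.ball (z : ℂ) (r z) : Set V))
    (fun z => Metric.isOpen_ball.preimage continuous_subtype_val)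
    (fun z => Metric.mem_ball_self (hr z)) (fun i y => F i y) (by
      intro i j x hx
      -- the difference of two primitives has derivative zero on a convex neighbourhood
      obtain ⟨ε, hε, hεs⟩ := Metric.isOpen_iff.1
        (Metric.isOpen_ball.inter Metric.isOpen_ball) (x : ℂ) (And.intro hx.1 hx.2)
      have : ∀ y ∈ Metric.ball (x : ℂ) ε, F i y - F j y = F i x - F j x := by
        intro y hy
        have hd : ∀ t ∈ Metric.ball (x : ℂ) ε, HasDerivAt (fun t => F i t - F j t) 0 t := by
          intro t ht
          simpa using (hF i t (hεs ht).1).fun_sub (hF j t (hεs ht).2)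
        exact Metric.isOpen_ball.is_const_of_deriv_eq_zero
          (convex_ball (x : ℂ) ε).isPreconnected
          (fun t ht => (hd t ht).differentiableAt.differentiableWithinAt)
          (fun t ht => (hd t ht).deriv) hy (Metric.mem_ball_self hε)
      filter_upwards [(continuous_subtype_val.tendsto x).eventually
        (Metric.ball_mem_nhds (x : ℂ) hε)] with y hy using this y hy)
  classical
  refine ⟨fun z => if hz : z ∈ V then g ⟨z, hz⟩ else 0, fun z hz => ?_⟩
  have h1 := hg ⟨z, hz⟩ ⟨z, hz⟩ (Metric.mem_ball_self (hr _))
  rw [nhds_subtype_eq_comap, Filter.eventually_comap] at h1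
  have h2 : (fun y => if hy : y ∈ V then g ⟨y, hy⟩ else 0) =ᶠ[nhds z]
      fun y => F ⟨z, hz⟩ y + (g ⟨z, hz⟩ - F ⟨z, hz⟩ z) := by
    filter_upwards [h1, hVo.mem_nhds hz] with y hy hyV
    rw [dif_pos hyV, ← hy ⟨y, hyV⟩ rfl]
    abel
  exact ((hF ⟨z, hz⟩ z (Metric.mem_ball_self (hr _))).add_const _).congr_of_eventuallyEq h2

/-! ### Linear differential equations on simply connected domains -/

/-- If `u (n+1) = a (n+1) + u n / 2` with `a` summable, then `u` is summable. -/
theorem summable_of_half_recursion {a u : ℕ → ℝ} (ha : Summable a) (ha0 : ∀ n, 0 ≤ a n)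
    (hu0 : 0 ≤ u 0) (hu : ∀ n, u (n + 1) = a (n + 1) + u n / 2) : Summable u := by
  have hpos : ∀ n, 0 ≤ u n := by
    intro n
    induction n with
    | zero => exact hu0
    | succ n ih => rw [hu]; have := ha0 (n + 1); positivity
  have key : ∀ n, ∑ i ∈ Finset.range (n + 1), u i
      ≤ 2 * (u 0 + ∑ i ∈ Finset.range (n + 1), a i) - u n := by
    intro n
    induction n with
    | zero =>
      have := ha0 0
      simp only [zero_add, Finset.sum_range_one]
      linarith
    | succ n ih =>
      rw [Finset.sum_range_succ, Finset.sum_range_succ a]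
      have := hu n
      linarith
  refine summable_of_sum_range_le (c := 2 * (u 0 + ∑' n, a n)) hpos fun n => ?_
  have h1 := key n
  rw [Finset.sum_range_succ] at h1
  have h2 := ha.sum_le_tsum (Finset.range (n + 1)) fun i _ => ha0 i
  have h3 := hpos n
  linarith

/-- On a simply connected domain every linear equation `Y' = A(z) Y` with holomorphic coefficients
has a solution with prescribed value at one point. It is the sum of the Picard iterates
`Yₙ₊₁ = ∫ A Yₙ`, and the set where that series converges absolutely is open and closed in `V`. -/
theorem exists_hasDerivAt_linear {E : Type*} [NormedAddCommGroup E] [NormedSpace ℂ E]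
    [CompleteSpace E] {V : Set ℂ} (hVo : IsOpen V) (hVs : IsSimplyConnected V)
    {A : ℂ → E →L[ℂ] E} (hA : DifferentiableOn ℂ A V) {z₀ : ℂ} (hz₀ : z₀ ∈ V) (y₀ : E) :
    ∃ Y : ℂ → E, Y z₀ = y₀ ∧ ∀ z ∈ V, HasDerivAt Y (A z (Y z)) z := by
  have hstep : ∀ Y : {Y : ℂ → E // DifferentiableOn ℂ Y V},
      ∃ Y' : {Y : ℂ → E // DifferentiableOn ℂ Y V},
        Y'.1 z₀ = 0 ∧ ∀ z ∈ V, HasDerivAt Y'.1 (A z (Y.1 z)) z := by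
    rintro ⟨Y, hY⟩
    obtain ⟨G, hG0, hG⟩ := (DifferentiableOn.isExactOn_of_isSimplyConnected hVo hVs
      (hA.clm_apply hY)).with_val_at z₀ 0
    exact ⟨⟨G, fun z hz => (hG z hz).differentiableAt.differentiableWithinAt⟩, hG0, hG⟩
  choose S hS0 hS using hstep
  let Z : ℕ → {Y : ℂ → E // DifferentiableOn ℂ Y V} := fun n =>
    S^[n] ⟨fun _ => y₀, differentiableOn_const _⟩
  let Y : ℕ → ℂ → E := fun n => (Z n).1
  have hY0 : ∀ z, Y 0 z = y₀ := fun z => rfl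
  have hZs : ∀ n, Z (n + 1) = S (Z n) := fun n => Function.iterate_succ_apply' S n _
  have hYz : ∀ n, Y (n + 1) z₀ = 0 := fun n => by simp only [Y, hZs, hS0]
  have hYd : ∀ n, ∀ z ∈ V, HasDerivAt (Y (n + 1)) (A z (Y n z)) z := fun n z hz => by
    simp only [Y, hZs]; exact hS _ z hz
  -- absolute convergence at one point of a small ball spreads uniformly to the whole ball
  have hloc : ∀ z₁ ∈ V, ∃ r > 0, Metric.ball z₁ r ⊆ V ∧ ∃ M : ℝ, 0 ≤ M ∧
      (∀ z ∈ Metric.ball z₁ r, ‖A z‖ ≤ M) ∧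
      ∀ z₂ ∈ Metric.ball z₁ r, Summable (fun n => ‖Y n z₂‖) →
        ∃ u : ℕ → ℝ, Summable u ∧ ∀ n, ∀ z ∈ Metric.ball z₁ r, ‖Y n z‖ ≤ u n := by
    intro z₁ hz₁
    set M : ℝ := ‖A z₁‖ + 1 with hM
    have hMpos : 0 < M := by positivity
    have hcont : ContinuousAt A z₁ := (hA.differentiableAt (hVo.mem_nhds hz₁)).continuousAt
    have hev : ∀ᶠ z in nhds z₁, ‖A z‖ ≤ M :=
      (hcont.norm.eventually_lt_const (by rw [hM]; linarith)).mono fun z hz => le_of_lt hz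
    obtain ⟨r₀, hr₀, hr₀s⟩ := Metric.eventually_nhds_iff_ball.1 (hev.and (hVo.mem_nhds hz₁))
    refine ⟨min r₀ (1 / (4 * M)), lt_min hr₀ (by positivity), ?_, M, hMpos.le, ?_, ?_⟩
    · exact fun z hz => (hr₀s z (Metric.ball_subset_ball (min_le_left _ _) hz)).2
    · exact fun z hz => (hr₀s z (Metric.ball_subset_ball (min_le_left _ _) hz)).1
    · intro z₂ hz₂ hsum
      set r := min r₀ (1 / (4 * M)) with hr
      -- `2 r M ≤ 1/2`, so `Yₙ₊₁` varies on the ball by at most half of a bound for `Yₙ`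
      let u : ℕ → ℝ := fun n => Nat.rec ‖y₀‖ (fun n v => ‖Y (n + 1) z₂‖ + v / 2) n
      refine ⟨u, summable_of_half_recursion hsum (fun _ => norm_nonneg _) (norm_nonneg _)
        (fun n => rfl), fun n => ?_⟩
      induction n with
      | zero => intro z _; exact (congrArg norm (hY0 z)).le
      | succ n ih =>
        intro z hz
        have hun : 0 ≤ u n := (norm_nonneg _).trans (ih z hz)
        have h1 : ‖Y (n + 1) z - Y (n + 1) z₂‖ ≤ (M * u n) * ‖z - z₂‖ := by
          refine (convex_ball z₁ r).norm_image_sub_le_of_norm_hasDerivWithin_le (𝕜 := ℂ)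
            (f' := fun z => A z (Y n z)) (fun t ht => ?_) (fun t ht => ?_) hz₂ hz
          · exact (hYd n t (hr₀s t (Metric.ball_subset_ball (min_le_left _ _) ht)).2
              ).hasDerivWithinAt
          · exact (A t).le_of_opNorm_le_of_le
              (hr₀s t (Metric.ball_subset_ball (min_le_left _ _) ht)).1 (ih t ht)
        have h2 : ‖z - z₂‖ ≤ 2 * r := by
          have := dist_triangle_right z z₂ z₁
          rw [Metric.mem_ball] at hz hz₂
          rw [← dist_eq_norm]
          linarith
        have h3 : M * (2 * r) ≤ 1 / 2 := by
          have : r ≤ 1 / (4 * M) := min_le_right _ _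
          calc M * (2 * r) ≤ M * (2 * (1 / (4 * M))) := by gcongr
            _ = 1 / 2 := by field_simp; norm_num
        have h4 : (M * u n) * ‖z - z₂‖ ≤ u n / 2 := by
          calc (M * u n) * ‖z - z₂‖ ≤ (M * u n) * (2 * r) := by gcongr
            _ = (M * (2 * r)) * u n := by ring
            _ ≤ 1 / 2 * u n := by gcongr
            _ = u n / 2 := by ring
        have h5 := norm_le_norm_add_norm_sub' (Y (n + 1) z) (Y (n + 1) z₂)
        change _ ≤ ‖Y (n + 1) z₂‖ + u n / 2
        linarith
  have hopen : ∀ z ∈ V, (Summable fun n => ‖Y n z‖) →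
      z ∈ interior {z | Summable fun n => ‖Y n z‖} := by
    intro z hz hs
    obtain ⟨r, hr, hrV, M, -, -, hu⟩ := hloc z hz
    obtain ⟨u, hus, hub⟩ := hu z (Metric.mem_ball_self hr) hs
    refine mem_interior.2 ⟨Metric.ball z r, fun t ht => ?_, Metric.isOpen_ball,
      Metric.mem_ball_self hr⟩
    exact hus.of_nonneg_of_le (fun _ => norm_nonneg _) fun n => hub n t ht
  have hsum : ∀ z ∈ V, Summable fun n => ‖Y n z‖ := by
    have hV : V ⊆ {z | Summable fun n => ‖Y n z‖} := by
      refine hVs.isPathConnected.isConnected.isPreconnected.subset_of_closure_inter_subset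
        (s := V) (u := interior {z | Summable fun n => ‖Y n z‖}) isOpen_interior
        ⟨z₀, hz₀, ?_⟩ ?_ |>.trans interior_subset
      · refine hopen z₀ hz₀ ?_
        refine summable_of_ne_finset_zero (s := {0}) fun n hn => ?_
        obtain ⟨m, rfl⟩ := Nat.exists_eq_succ_of_ne_zero (by simpa using hn)
        simp [hYz]
      · rintro z ⟨hzc, hz⟩
        obtain ⟨r, hr, hrV, M, -, -, hu⟩ := hloc z hz
        obtain ⟨t, hts, htr⟩ := Metric.mem_closure_iff.1 hzc r hr
        have hts' : t ∈ {z | Summable fun n => ‖Y n z‖} := interior_subset hts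
        obtain ⟨u, hus, hub⟩ := hu t (by rwa [Metric.mem_ball, dist_comm]) hts'
        exact hopen z hz (hus.of_nonneg_of_le (fun _ => norm_nonneg _)
          fun n => hub n z (Metric.mem_ball_self hr))
    exact hV
  refine ⟨fun z => ∑' n, Y n z, ?_, fun z hz => ?_⟩
  · beta_reduce
    rw [tsum_eq_single 0 (fun n hn => ?_), hY0]
    obtain ⟨m, rfl⟩ := Nat.exists_eq_succ_of_ne_zero hn
    exact hYz m
  · obtain ⟨r, hr, hrV, M, hM0, hM, hu⟩ := hloc z hz
    obtain ⟨u, hus, hub⟩ := hu z (Metric.mem_ball_self hr) (hsum z hz)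
    have hd := hasDerivAt_tsum_of_isPreconnected (𝕜 := ℂ) (hus.mul_left M) Metric.isOpen_ball
      (convex_ball z r).isPreconnected (g := fun n => Y (n + 1)) (g' := fun n t => A t (Y n t))
      (fun n t ht => hYd n t (hrV ht))
      (fun n t ht => (A t).le_of_opNorm_le_of_le (hM t ht) (hub n t ht))
      (Metric.mem_ball_self hr) ((summable_nat_add_iff 1).2 (hsum z hz).of_norm)
      (Metric.mem_ball_self hr)
    rw [(A z).map_tsum (hsum z hz).of_norm]
    refine (hd.const_add y₀).congr_of_eventuallyEq ?_
    filter_upwards [hVo.mem_nhds hz] with t ht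
    rw [(hsum t ht).of_norm.tsum_eq_zero_add, hY0]

/-! ### Existence of pairs of solutions of Hill's equation -/

theorem exists_isHillPair {V : Set ℂ} (hVo : IsOpen V) (hVs : IsSimplyConnected V)
    {ρ : ℂ → ℂ} (hρ : DifferentiableOn ℂ ρ V) : ∃ w : ℂ → Fin 2 → ℂ, IsHillPair V ρ w := by
  obtain ⟨z₀, hz₀⟩ := hVs.nonempty
  -- the first order system `(y, y')' = (y', -(ρ / 4) y)`
  let A : ℂ → (ℂ × ℂ) →L[ℂ] (ℂ × ℂ) := fun z =>
    (ContinuousLinearMap.inl ℂ ℂ ℂ).comp (ContinuousLinearMap.snd ℂ ℂ ℂ) +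
      (-ρ z / 4) • (ContinuousLinearMap.inr ℂ ℂ ℂ).comp (ContinuousLinearMap.fst ℂ ℂ ℂ)
  have hAz : ∀ z p, A z p = (p.2, -ρ z / 4 * p.1) := by intro z p; simp [A]
  have hA : DifferentiableOn ℂ A V :=
    (differentiableOn_const _).add ((hρ.neg.div_const 4).smul_const _)
  have hsol : ∀ a b : ℂ, ∃ y y' : ℂ → ℂ, y z₀ = a ∧ y' z₀ = b ∧
      (∀ z ∈ V, HasDerivAt y (y' z) z) ∧ ∀ z ∈ V, HasDerivAt y' (-ρ z / 4 * y z) z := by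
    intro a b
    obtain ⟨Y, hY0, hY⟩ := exists_hasDerivAt_linear hVo hVs hA hz₀ (a, b)
    refine ⟨fun z => (Y z).1, fun z => (Y z).2, by simp [hY0], by simp [hY0], fun z hz => ?_,
      fun z hz => ?_⟩
    · have := (hasFDerivAt_fst (𝕜 := ℂ) (p := Y z)).comp_hasDerivAt z (hY z hz)
      simpa [hAz, Function.comp_def] using this
    · have := (hasFDerivAt_snd (𝕜 := ℂ) (p := Y z)).comp_hasDerivAt z (hY z hz)
      simpa [hAz, Function.comp_def] using this
  obtain ⟨f, f', hf0, hf0', hf, hf'⟩ := hsol 1 0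
  obtain ⟨g, g', hg0, hg0', hg, hg'⟩ := hsol 0 (1 / 2)
  have hdf : ∀ z ∈ V, deriv f z = f' z := fun z hz => (hf z hz).deriv
  have hdg : ∀ z ∈ V, deriv g z = g' z := fun z hz => (hg z hz).deriv
  have hW : ∀ z ∈ V, f z * g' z - g z * f' z = 1 / 2 := by
    intro z hz
    have hd : ∀ t ∈ V, HasDerivAt (fun t => f t * g' t - g t * f' t) 0 t := by
      intro t ht
      refine (((hf t ht).fun_mul (hg' t ht)).fun_sub
        ((hg t ht).fun_mul (hf' t ht))).congr_deriv ?_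
      ring
    have := hVo.is_const_of_deriv_eq_zero hVs.isPathConnected.isConnected.isPreconnected
      (fun t ht => (hd t ht).differentiableAt.differentiableWithinAt)
      (fun t ht => (hd t ht).deriv) hz hz₀
    rw [this, hf0, hf0', hg0, hg0']
    ring
  refine ⟨fun z => ![f z, g z], ?_, ?_, ?_⟩
  · intro i z hz
    fin_cases i
    · exact (hf z hz).differentiableAt.differentiableWithinAt
    · exact (hg z hz).differentiableAt.differentiableWithinAt
  · intro i z hz
    fin_cases i
    · have : deriv f =ᶠ[nhds z] f' := by
        filter_upwards [hVo.mem_nhds hz] with t ht using hdf t ht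
      simp [this.deriv_eq, (hf' z hz).deriv]
      ring
    · have : deriv g =ᶠ[nhds z] g' := by
        filter_upwards [hVo.mem_nhds hz] with t ht using hdg t ht
      simp [this.deriv_eq, (hg' z hz).deriv]
      ring
  · intro z hz
    simpa [hdf z hz, hdg z hz] using hW z hz

/-! ### Wirtinger calculus -/

/-- `f` is real differentiable at `p` with `df = a dz + b dz̄`. -/
def HasWirtingerAt (f : ℂ → ℂ) (a b p : ℂ) : Prop :=
  HasFDerivAt (𝕜 := ℝ) f
    (a • ContinuousLinearMap.id ℝ ℂ + b • (conjCLE : ℂ →L[ℝ] ℂ)) p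

namespace HasWirtingerAt

variable {f g : ℂ → ℂ} {a b c d p : ℂ}

theorem fderiv_apply (h : HasWirtingerAt f a b p) (v : ℂ) :
    fderiv ℝ f p v = a * v + b * star v := by
  rw [HasFDerivAt.fderiv h]
  simp

theorem wirtingerZ_eq (h : HasWirtingerAt f a b p) : wirtingerZ f p = a := by
  rw [wirtingerZ, h.fderiv_apply, h.fderiv_apply]
  simp only [RCLike.star_def, map_one, conj_I]
  linear_combination (b - a) / 2 * I_sq

theorem wirtingerZbar_eq (h : HasWirtingerAt f a b p) : wirtingerZbar f p = b := by
  rw [wirtingerZbar, h.fderiv_apply, h.fderiv_apply]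
  simp only [RCLike.star_def, map_one, conj_I]
  linear_combination (a - b) / 2 * I_sq

theorem congr_of_eventuallyEq (h : HasWirtingerAt f a b p) (hg : g =ᶠ[nhds p] f) :
    HasWirtingerAt g a b p :=
  HasFDerivAt.congr_of_eventuallyEq h hg

theorem congr_deriv (h : HasWirtingerAt f a b p) (ha : a = c) (hb : b = d) :
    HasWirtingerAt f c d p := ha ▸ hb ▸ h

theorem add (hf : HasWirtingerAt f a b p) (hg : HasWirtingerAt g c d p) :
    HasWirtingerAt (fun z => f z + g z) (a + c) (b + d) p := by
  refine (HasFDerivAt.fun_add hf hg).congr_fderiv ?_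
  ext
  simp
  ring

theorem neg (hf : HasWirtingerAt f a b p) : HasWirtingerAt (fun z => -f z) (-a) (-b) p := by
  refine (HasFDerivAt.fun_neg hf).congr_fderiv ?_
  ext
  simp
  ring

theorem sub (hf : HasWirtingerAt f a b p) (hg : HasWirtingerAt g c d p) :
    HasWirtingerAt (fun z => f z - g z) (a - c) (b - d) p := by
  simpa only [sub_eq_add_neg] using hf.add hg.neg

theorem mul (hf : HasWirtingerAt f a b p) (hg : HasWirtingerAt g c d p) :
    HasWirtingerAt (fun z => f z * g z) (a * g p + f p * c) (b * g p + f p * d) p := by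
  refine (HasFDerivAt.fun_mul hf hg).congr_fderiv ?_
  ext
  simp
  ring

theorem conj (hf : HasWirtingerAt f a b p) :
    HasWirtingerAt (fun z => star (f z)) (star b) (star a) p := by
  refine ((conjCLE : ℂ →L[ℝ] ℂ).hasFDerivAt.comp p hf).congr_fderiv ?_
  ext
  simp
  ring

theorem comp_hasDerivAt {h : ℂ → ℂ} {h' : ℂ} (hh : HasDerivAt h h' (f p))
    (hf : HasWirtingerAt f a b p) :
    HasWirtingerAt (fun z => h (f z)) (h' * a) (h' * b) p := by
  refine ((hh.hasFDerivAt.restrictScalars ℝ).comp p hf).congr_fderiv ?_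
  ext
  simp
  ring

end HasWirtingerAt

theorem HasDerivAt.hasWirtingerAt {f : ℂ → ℂ} {f' p : ℂ} (h : HasDerivAt f f' p) :
    HasWirtingerAt f f' 0 p := by
  refine (h.hasFDerivAt.restrictScalars ℝ).congr_fderiv ?_
  ext
  simp [mul_comm]

theorem DifferentiableAt.hasWirtingerAt {f : ℂ → ℂ} {p : ℂ} (h : DifferentiableAt ℝ f p) :
    HasWirtingerAt f (wirtingerZ f p) (wirtingerZbar f p) p := by
  refine h.hasFDerivAt.congr_fderiv ?_
  ext v
  have hv : v = v.re • (1 : ℂ) + v.im • I := by simp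
  have hf : fderiv ℝ f p v = v.re * fderiv ℝ f p 1 + v.im * fderiv ℝ f p I := by
    conv_lhs => rw [hv, map_add, map_smul, map_smul]
    simp
  have hre : v + star v = 2 * v.re := by simpa using add_conj v
  have him : v - star v = 2 * v.im * I := by simpa using sub_conj v
  simp only [wirtingerZ, wirtingerZbar, _root_.add_apply,
    _root_.smul_apply, ContinuousLinearMap.id_apply, smul_eq_mul,
    ContinuousLinearEquiv.coe_coe, conjCLE_apply, ← RCLike.star_def, hf]
  linear_combination -fderiv ℝ f p 1 / 2 * hre + I * fderiv ℝ f p I / 2 * him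
    + v.im * fderiv ℝ f p I * I_sq

/-- A function both of whose Wirtinger derivatives vanish on a domain is constant there. -/
theorem eq_of_hasWirtingerAt_zero {V : Set ℂ} (hVo : IsOpen V) (hV : IsPreconnected V)
    {f : ℂ → ℂ} (hf : ∀ z ∈ V, HasWirtingerAt f 0 0 z) {x y : ℂ} (hx : x ∈ V) (hy : y ∈ V) :
    f x = f y := by
  have h : ∀ z ∈ V, HasFDerivAt (𝕜 := ℝ) f 0 z := fun z hz => by
    refine HasFDerivAt.congr_fderiv (hf z hz) ?_
    ext
    simp
  exact hVo.is_const_of_fderiv_eq_zero (𝕜 := ℝ) hV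
    (fun z hz => (h z hz).differentiableAt.differentiableWithinAt)
    (fun z hz => (h z hz).fderiv) hx hy

theorem fderiv_ofReal_comp {u : ℂ → ℝ} {p : ℂ} (h : DifferentiableAt ℝ u p) (v : ℂ) :
    fderiv ℝ (fun z => (u z : ℂ)) p v = (fderiv ℝ u p v : ℝ) := by
  have := (ofRealCLM.hasFDerivAt.comp p h.hasFDerivAt).fderiv
  change fderiv ℝ (fun z => (u z : ℂ)) p = _ at this
  rw [this]
  simp

theorem DifferentiableAt.ofReal_hasWirtingerAt {u : ℂ → ℝ} {p : ℂ}
    (h : DifferentiableAt ℝ u p) :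
    HasWirtingerAt (fun z => (u z : ℂ)) (wirtingerZ (fun z => (u z : ℂ)) p)
      (star (wirtingerZ (fun z => (u z : ℂ)) p)) p := by
  have h1 : DifferentiableAt ℝ (fun z => (u z : ℂ)) p := ofRealCLM.differentiableAt.comp p h
  refine h1.hasWirtingerAt.congr_deriv rfl ?_
  rw [wirtingerZ, wirtingerZbar, fderiv_ofReal_comp h, fderiv_ofReal_comp h]
  simp

theorem contDiffOn_wirtingerZ {V : Set ℂ} (hVo : IsOpen V) {f : ℂ → ℂ}
    (hf : ContDiffOn ℝ ∞ f V) : ContDiffOn ℝ ∞ (wirtingerZ f) V := by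
  have h1 : ∀ v : ℂ, ContDiffOn ℝ ∞ (fun z => fderiv ℝ f z v) V := fun v =>
    (hf.fderiv_of_isOpen hVo (by simp)).clm_apply contDiffOn_const
  unfold wirtingerZ
  exact ((h1 1).sub (contDiffOn_const.mul (h1 I))).div_const 2

/-! ### The system for `u` as a first order system -/

/-- The system for `u` says that `U = ∂u/∂z` has `∂U/∂z = -ρ/4 - U²` and `∂U/∂z̄ = e^{-2u}/4`. -/
theorem IsLiouvilleSolution.hasWirtingerAt {V : Set ℂ} (hVo : IsOpen V) {ρ : ℂ → ℂ} {u : ℂ → ℝ}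
    (hu : IsLiouvilleSolution V ρ u) {z : ℂ} (hz : z ∈ V) :
    HasWirtingerAt (fun p => (u p : ℂ)) (wirtingerZ (fun p => (u p : ℂ)) z)
      (star (wirtingerZ (fun p => (u p : ℂ)) z)) z ∧
    HasWirtingerAt (wirtingerZ fun p => (u p : ℂ))
      (-ρ z / 4 - (wirtingerZ (fun p => (u p : ℂ)) z) ^ 2)
      ((Real.exp (-2 * u z) : ℝ) / 4) z := by
  have hd : ∀ p ∈ V, DifferentiableAt ℝ u p := fun p hp =>
    (hu.smooth.contDiffAt (hVo.mem_nhds hp)).differentiableAt (by simp)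
  refine ⟨(hd z hz).ofReal_hasWirtingerAt, ?_⟩
  have hs : ContDiffOn ℝ ∞ (fun p => (u p : ℂ)) V := ofRealCLM.contDiff.comp_contDiffOn hu.smooth
  have hU : DifferentiableAt ℝ (wirtingerZ fun p => (u p : ℂ)) z :=
    ((contDiffOn_wirtingerZ hVo hs).contDiffAt (hVo.mem_nhds hz)).differentiableAt (by simp)
  have hconj : (wirtingerZbar fun p => (u p : ℂ)) =ᶠ[nhds z]
      fun p => star (wirtingerZ (fun p => (u p : ℂ)) p) := by
    filter_upwards [hVo.mem_nhds hz] with p hp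
    exact (hd p hp).ofReal_hasWirtingerAt.wirtingerZbar_eq
  have h1 := (hU.hasWirtingerAt.conj.congr_of_eventuallyEq hconj).wirtingerZ_eq
  have h2 := hu.liouville z hz
  have h3 := hu.schwarzian z hz
  refine hU.hasWirtingerAt.congr_deriv (by linear_combination h3) ?_
  rw [h1] at h2
  have h4 := congrArg star h2
  simp only [star_mul', star_star] at h4
  rw [RCLike.star_def, conj_ofReal] at h4
  simp only [map_ofNat] at h4
  linear_combination h4 / 4

theorem IsLiouvilleSolution.of_hasWirtingerAt {V : Set ℂ} (hVo : IsOpen V) {ρ : ℂ → ℂ} {u : ℂ → ℝ}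
    (hs : ContDiffOn ℝ ∞ u V) {U : ℂ → ℂ}
    (hu : ∀ z ∈ V, HasWirtingerAt (fun p => (u p : ℂ)) (U z) (star (U z)) z)
    (hU : ∀ z ∈ V, HasWirtingerAt U (-ρ z / 4 - U z ^ 2) ((Real.exp (-2 * u z) : ℝ) / 4) z) :
    IsLiouvilleSolution V ρ u := by
  have h1 : ∀ z ∈ V, (wirtingerZ fun p => (u p : ℂ)) =ᶠ[nhds z] U := fun z hz => by
    filter_upwards [hVo.mem_nhds hz] with p hp using (hu p hp).wirtingerZ_eq
  have h2 : ∀ z ∈ V, (wirtingerZbar fun p => (u p : ℂ)) =ᶠ[nhds z] fun p => star (U p) :=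
    fun z hz => by
      filter_upwards [hVo.mem_nhds hz] with p hp using (hu p hp).wirtingerZbar_eq
  refine ⟨hs, fun z hz => ?_, fun z hz => ?_⟩
  · rw [((hU z hz).conj.congr_of_eventuallyEq (h2 z hz)).wirtingerZ_eq]
    simp only [star_div₀, RCLike.star_def, conj_ofReal, map_ofNat]
    ring
  · rw [((hU z hz).congr_of_eventuallyEq (h1 z hz)).wirtingerZ_eq, (h1 z hz).self_of_nhds]
    ring

theorem IsLiouvilleSolution.congr {V : Set ℂ} (hVo : IsOpen V) {ρ : ℂ → ℂ} {u v : ℂ → ℝ}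
    (hu : IsLiouvilleSolution V ρ u) (h : ∀ z ∈ V, v z = u z) : IsLiouvilleSolution V ρ v := by
  refine .of_hasWirtingerAt hVo (hu.smooth.congr h) (U := wirtingerZ fun p => (u p : ℂ))
    (fun z hz => ?_) (fun z hz => ?_)
  · refine (hu.hasWirtingerAt hVo hz).1.congr_of_eventuallyEq ?_
    filter_upwards [hVo.mem_nhds hz] with p hp
    rw [h p hp]
  · rw [h z hz]
    exact (hu.hasWirtingerAt hVo hz).2

/-! ### The potential of a pair of solutions of Hill's equation -/

/-- The logarithmic derivative `∂u_w/∂z = ⟨w', w⟩ / |w|²`. -/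
noncomputable def hillLogDeriv (w : ℂ → Fin 2 → ℂ) (z : ℂ) : ℂ :=
  (deriv (fun p => w p 0) z * star (w z 0) + deriv (fun p => w p 1) z * star (w z 1)) *
    (hillNormSq w z : ℂ)⁻¹

namespace IsHillPair

variable {V : Set ℂ} {ρ : ℂ → ℂ} {w : ℂ → Fin 2 → ℂ}

theorem hasDerivAt (hw : IsHillPair V ρ w) (hVo : IsOpen V) (i : Fin 2) {z : ℂ} (hz : z ∈ V) :
    HasDerivAt (fun p => w p i) (deriv (fun p => w p i) z) z :=
  ((hw.holomorphic i).differentiableAt (hVo.mem_nhds hz)).hasDerivAt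

theorem hasDerivAt_deriv (hw : IsHillPair V ρ w) (hVo : IsOpen V) (i : Fin 2) {z : ℂ}
    (hz : z ∈ V) :
    HasDerivAt (deriv fun p => w p i) (-ρ z / 4 * w z i) z := by
  have h := (((hw.holomorphic i).deriv hVo).differentiableAt (hVo.mem_nhds hz)).hasDerivAt
  exact h.congr_deriv (by linear_combination hw.ode i z hz)

theorem hillNormSq_pos (hw : IsHillPair V ρ w) {z : ℂ} (hz : z ∈ V) : 0 < hillNormSq w z := by
  have h := hw.wronskian z hz
  rw [hillNormSq]
  by_cases h0 : w z 0 = 0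
  · have h1 : w z 1 ≠ 0 := by
      intro h1
      simp [h0, h1] at h
    positivity
  · positivity

theorem ofReal_hillNormSq (w : ℂ → Fin 2 → ℂ) (z : ℂ) :
    (hillNormSq w z : ℂ) = w z 0 * star (w z 0) + w z 1 * star (w z 1) := by
  simp [hillNormSq, mul_conj, normSq_eq_norm_sq]

theorem hasWirtingerAt_hillNormSq (hw : IsHillPair V ρ w) (hVo : IsOpen V) {z : ℂ} (hz : z ∈ V) :
    HasWirtingerAt (fun p => (hillNormSq w p : ℂ))
      (deriv (fun p => w p 0) z * star (w z 0) + deriv (fun p => w p 1) z * star (w z 1))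
      (star (deriv (fun p => w p 0) z * star (w z 0) + deriv (fun p => w p 1) z * star (w z 1)))
      z := by
  simp only [ofReal_hillNormSq]
  have h : ∀ i, _ := fun i => (hw.hasDerivAt hVo i hz).hasWirtingerAt
  refine (((h 0).mul (h 0).conj).add ((h 1).mul (h 1).conj)).congr_deriv ?_ ?_
  · simp
  · simp [mul_comm]

theorem hasWirtingerAt_hillPotential (hw : IsHillPair V ρ w) (hVo : IsOpen V) {z : ℂ}
    (hz : z ∈ V) :
    HasWirtingerAt (fun p => (hillPotential w p : ℂ)) (hillLogDeriv w z)
      (star (hillLogDeriv w z)) z := by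
  have hN := hw.hillNormSq_pos hz
  have hlog : (fun p => (hillPotential w p : ℂ)) = fun p => Complex.log (hillNormSq w p : ℂ) := by
    funext p
    rw [hillPotential, ofReal_log]
    rw [hillNormSq]
    positivity
  rw [hlog]
  refine (HasWirtingerAt.comp_hasDerivAt (Complex.hasDerivAt_log (Or.inl ?_))
    (hw.hasWirtingerAt_hillNormSq hVo hz)).congr_deriv ?_ ?_
  · simpa using hN
  · rw [hillLogDeriv]; ring
  · simp [hillLogDeriv, mul_comm]

/-- The identity behind Liouville's equation: `|w|² |w'|² - |⟨w', w⟩|² = |w₁w₂' - w₂w₁'|²`. -/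
theorem hasWirtingerAt_hillLogDeriv (hw : IsHillPair V ρ w) (hVo : IsOpen V) {z : ℂ}
    (hz : z ∈ V) :
    HasWirtingerAt (hillLogDeriv w) (-ρ z / 4 - hillLogDeriv w z ^ 2)
      ((Real.exp (-2 * hillPotential w z) : ℝ) / 4) z := by
  have hN := hw.hillNormSq_pos hz
  have hN0 : (hillNormSq w z : ℂ) ≠ 0 := by exact_mod_cast hN.ne'
  have hexp : ((Real.exp (-2 * hillPotential w z) : ℝ) : ℂ) = ((hillNormSq w z : ℂ) ^ 2)⁻¹ := by
    have : Real.exp (-2 * hillPotential w z) = (hillNormSq w z ^ 2)⁻¹ := by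
      rw [hillPotential, neg_mul, Real.exp_neg, two_mul, Real.exp_add, Real.exp_log hN, sq]
    rw [this]
    push_cast
    rfl
  have h : ∀ i, _ := fun i => (hw.hasDerivAt hVo i hz).hasWirtingerAt
  have h' : ∀ i, _ := fun i => (hw.hasDerivAt_deriv hVo i hz).hasWirtingerAt
  have hinv := HasWirtingerAt.comp_hasDerivAt (hasDerivAt_inv hN0)
    (hw.hasWirtingerAt_hillNormSq hVo hz)
  refine ((((h' 0).mul (h 0).conj).add ((h' 1).mul (h 1).conj)).mul hinv).congr_deriv ?_ ?_
  · rw [hillLogDeriv]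
    field_simp
    rw [ofReal_hillNormSq]
    simp only [star_zero]
    ring
  · rw [hexp]
    have hW := hw.wronskian z hz
    have hW' := congrArg star hW
    simp only [star_sub, star_mul', star_div₀, star_one, star_ofNat] at hW'
    field_simp
    rw [ofReal_hillNormSq]
    simp only [star_add, star_mul', star_star]
    linear_combination 4 * (star (w z 0) * star (deriv (fun p => w p 1) z)
      - star (w z 1) * star (deriv (fun p => w p 0) z)) * hW + 2 * hW'

theorem isLiouvilleSolution (hw : IsHillPair V ρ w) (hVo : IsOpen V) :
    IsLiouvilleSolution V ρ (hillPotential w) := by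
  refine .of_hasWirtingerAt hVo ?_ (fun z hz => hw.hasWirtingerAt_hillPotential hVo hz)
    (fun z hz => hw.hasWirtingerAt_hillLogDeriv hVo hz)
  have h : ∀ i, ContDiffOn ℝ ∞ (fun p => w p i) V := fun i =>
    ((hw.holomorphic i).contDiffOn hVo).restrict_scalars ℝ
  exact (((h 0).norm_sq ℝ).add ((h 1).norm_sq ℝ)).log fun z hz => (hw.hillNormSq_pos hz).ne'

end IsHillPair

/-! ### Uniqueness for the system -/

/-- The function `φ = e^u` together with `P = ∂φ/∂z` and `R = ∂²φ/∂z∂z̄` satisfies a closed linear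
first order system with coefficients `ρ/4` and its conjugate. -/
theorem IsLiouvilleSolution.hasWirtingerAt_exp {V : Set ℂ} (hVo : IsOpen V) {ρ : ℂ → ℂ} {u : ℂ → ℝ}
    (hu : IsLiouvilleSolution V ρ u) :
    ∃ P R : ℂ → ℂ, (∀ z, P z = Real.exp (u z) * wirtingerZ (fun p => (u p : ℂ)) z) ∧
      (∀ z, R z = Real.exp (u z) * (wirtingerZ (fun p => (u p : ℂ)) z *
        star (wirtingerZ (fun p => (u p : ℂ)) z)) + Real.exp (-u z) / 4) ∧
      ∀ z ∈ V, HasWirtingerAt (fun p => (Real.exp (u p) : ℂ)) (P z) (star (P z)) z ∧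
        HasWirtingerAt P (-ρ z / 4 * Real.exp (u z)) (R z) z ∧
        HasWirtingerAt R (-ρ z / 4 * star (P z)) (star (-ρ z / 4) * P z) z := by
  refine ⟨_, _, fun _ => rfl, fun _ => rfl, fun z hz => ?_⟩
  obtain ⟨h1, h2⟩ := hu.hasWirtingerAt hVo hz
  set U := wirtingerZ (fun p => (u p : ℂ)) with hU
  have he : HasWirtingerAt (fun p => (Real.exp (u p) : ℂ)) (Real.exp (u z) * U z)
      (Real.exp (u z) * star (U z)) z := by
    simp only [ofReal_exp]
    exact HasWirtingerAt.comp_hasDerivAt (Complex.hasDerivAt_exp _) h1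
  have hm : HasWirtingerAt (fun p => (Real.exp (-u p) : ℂ)) (Real.exp (-u z) * -U z)
      (Real.exp (-u z) * -star (U z)) z := by
    simp only [ofReal_exp, ofReal_neg]
    exact HasWirtingerAt.comp_hasDerivAt (Complex.hasDerivAt_exp _) h1.neg
  have hq : HasWirtingerAt (fun _ => (1 / 4 : ℂ)) 0 0 z :=
    (hasDerivAt_const z (1 / 4 : ℂ)).hasWirtingerAt
  have hmul : (Real.exp (-2 * u z) : ℂ) * Real.exp (u z) = Real.exp (-u z) := by
    rw [← ofReal_mul, ← Real.exp_add]
    ring_nf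
  have hstar : ∀ x : ℝ, star (x : ℂ) = x := fun x => conj_ofReal x
  refine ⟨he.congr_deriv rfl ?_, (he.mul h2).congr_deriv ?_ ?_, ?_⟩
  · simp only [star_mul', hstar]
  · ring
  · linear_combination hmul / 4
  · have := (he.mul (h2.mul h2.conj)).add (hm.mul hq)
    simp only [mul_one_div] at this
    refine this.congr_deriv ?_ ?_
    · simp only [star_div₀, star_ofNat, hstar, star_mul']
      linear_combination U z * hmul / 4
    · simp only [star_div₀, star_ofNat, star_sub, star_pow, star_neg]
      linear_combination star (U z) * hmul / 4

/-- A solution is determined by the values of `u` and `∂u/∂z` at one point. The difference `ψ` of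
two exponentials `e^u` solves the linear equations `ψ_zz = -(ρ/4) ψ`, `ψ_z̄z̄ = -(ρ̄/4) ψ`; its
double Wronskians with the functions `wᵢ w̄ⱼ` are constant, and they determine `ψ`. -/
theorem IsLiouvilleSolution.eqOn_of_eq_at {V : Set ℂ} (hVo : IsOpen V) (hV : IsPreconnected V)
    {ρ : ℂ → ℂ} {w : ℂ → Fin 2 → ℂ} (hw : IsHillPair V ρ w) {u v : ℂ → ℝ}
    (hu : IsLiouvilleSolution V ρ u) (hv : IsLiouvilleSolution V ρ v) {z₀ : ℂ} (hz₀ : z₀ ∈ V)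
    (h0 : u z₀ = v z₀)
    (h1 : wirtingerZ (fun p => (u p : ℂ)) z₀ = wirtingerZ (fun p => (v p : ℂ)) z₀) :
    ∀ z ∈ V, u z = v z := by
  obtain ⟨P, R, hP, hR, hd⟩ := hu.hasWirtingerAt_exp hVo
  obtain ⟨P', R', hP', hR', hd'⟩ := hv.hasWirtingerAt_exp hVo
  let ψ : ℂ → ℂ := fun z => Real.exp (u z) - Real.exp (v z)
  let p : ℂ → ℂ := fun z => P z - P' z
  let r : ℂ → ℂ := fun z => R z - R' z
  have hψ : ∀ z ∈ V, HasWirtingerAt ψ (p z) (star (p z)) z := fun z hz =>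
    ((hd z hz).1.sub (hd' z hz).1).congr_deriv rfl (by simp [p])
  have hp : ∀ z ∈ V, HasWirtingerAt p (-ρ z / 4 * ψ z) (r z) z := fun z hz =>
    ((hd z hz).2.1.sub (hd' z hz).2.1).congr_deriv (by simp only [ψ]; ring) rfl
  have hr : ∀ z ∈ V, HasWirtingerAt r (-ρ z / 4 * star (p z)) (star (-ρ z / 4) * p z) z :=
    fun z hz => ((hd z hz).2.2.sub (hd' z hz).2.2).congr_deriv
      (by simp only [p, star_sub]; ring) (by simp only [p]; ring)
  have hψ0 : ψ z₀ = 0 := by simp [ψ, h0]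
  have hp0 : p z₀ = 0 := by simp [p, hP, hP', h0, h1]
  have hr0 : r z₀ = 0 := by simp [r, hR, hR', h0, h1]
  have hrr : ∀ z, star (r z) = r z := fun z => by
    simp [r, hR, hR', mul_comm, -ofReal_exp]
  let D : Fin 2 → ℂ → ℂ := fun i => deriv fun p => w p i
  -- the Wronskian with `wᵢ` in the variable `z` and with `w̄ⱼ` in the variable `z̄`
  let C : Fin 2 → Fin 2 → ℂ → ℂ := fun i j z =>
    ψ z * (D i z * star (D j z)) - p z * (w z i * star (D j z))
      - star (p z) * (D i z * star (w z j)) + r z * (w z i * star (w z j))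
  have hC : ∀ i j, ∀ z ∈ V, C i j z = 0 := by
    intro i j z hz
    have hconst : ∀ z ∈ V, HasWirtingerAt (C i j) 0 0 z := by
      intro z hz
      have hw1 : ∀ i, _ := fun i => (hw.hasDerivAt hVo i hz).hasWirtingerAt
      have hw2 : ∀ i, _ := fun i => (hw.hasDerivAt_deriv hVo i hz).hasWirtingerAt
      refine (((((hψ z hz).mul ((hw2 i).mul (hw2 j).conj)).sub
        ((hp z hz).mul ((hw1 i).mul (hw2 j).conj))).sub
        ((hp z hz).conj.mul ((hw2 i).mul (hw1 j).conj))).add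
        ((hr z hz).mul ((hw1 i).mul (hw1 j).conj))).congr_deriv ?_ ?_
      · simp only [hrr, star_zero]
        ring
      · simp only [star_mul', show star (ψ z) = ψ z by simp [ψ, -ofReal_exp]]
        ring
    rw [eq_of_hasWirtingerAt_zero hVo hV hconst hz hz₀]
    simp [C, hψ0, hp0, hr0]
  intro z hz
  have hW : w z 0 * D 1 z - w z 1 * D 0 z = 1 / 2 := hw.wronskian z hz
  have hW' := congrArg star hW
  simp only [star_sub, star_mul', star_div₀, star_one, star_ofNat] at hW'
  -- the alternating combination of the `C i j` with coefficients `wₖ w̄ₗ` is `ψ` times the square of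
  -- the absolute value of the Wronskian of `w`
  have hψz : ψ z = 0 := by
    have h00 := hC 0 0 z hz
    have h01 := hC 0 1 z hz
    have h10 := hC 1 0 z hz
    have h11 := hC 1 1 z hz
    simp only [C] at h00 h01 h10 h11
    linear_combination 4 * (w z 1 * star (w z 1) * h00 - w z 1 * star (w z 0) * h01
      - w z 0 * star (w z 1) * h10 + w z 0 * star (w z 0) * h11)
      - 4 * ψ z * (star (w z 0) * star (D 1 z) - star (w z 1) * star (D 0 z)) * hW - 2 * ψ z * hW'
  have : Real.exp (u z) = Real.exp (v z) := by
    have := sub_eq_zero.1 hψz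
    exact_mod_cast this
  exact Real.exp_injective this

/-! ### The action of `SL(2, ℂ)` on pairs of solutions -/

theorem hillTransform_apply (B : SL(2, ℂ)) (w : ℂ → Fin 2 → ℂ) (z : ℂ) (i : Fin 2) :
    hillTransform B w z i = B i 0 * w z 0 + B i 1 * w z 1 := by
  simp [hillTransform, mulVec, dotProduct, Fin.sum_univ_two]

theorem hillTransform_mul (A B : SL(2, ℂ)) (w : ℂ → Fin 2 → ℂ) :
    hillTransform (A * B) w = hillTransform A (hillTransform B w) := by
  funext z
  change ((A * B : SL(2, ℂ)) : Matrix (Fin 2) (Fin 2) ℂ) *ᵥ w z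
    = (A : Matrix (Fin 2) (Fin 2) ℂ) *ᵥ ((B : Matrix (Fin 2) (Fin 2) ℂ) *ᵥ w z)
  rw [mulVec_mulVec]
  rfl

theorem det_SL2 (B : SL(2, ℂ)) : B 0 0 * B 1 1 - B 0 1 * B 1 0 = 1 := by
  rw [← det_fin_two]
  exact B.2

theorem mem_subgroupSU2_iff {B : SL(2, ℂ)} :
    B ∈ subgroupSU2 ↔ (B : Matrix (Fin 2) (Fin 2) ℂ)ᴴ * B = 1 := by
  change (B : Matrix (Fin 2) (Fin 2) ℂ) ∈ specialUnitaryGroup (Fin 2) ℂ ↔ _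
  rw [mem_specialUnitaryGroup_iff, mem_unitaryGroup_iff']
  exact and_iff_left B.2

theorem hillNormSq_hillTransform_of_mem {B : SL(2, ℂ)} (hB : B ∈ subgroupSU2)
    (w : ℂ → Fin 2 → ℂ) (z : ℂ) : hillNormSq (hillTransform B w) z = hillNormSq w z := by
  have h : ∀ w : ℂ → Fin 2 → ℂ, ((hillNormSq w z : ℝ) : ℂ) = star (w z) ⬝ᵥ w z := fun w => by
    rw [IsHillPair.ofReal_hillNormSq]
    simp [dotProduct, Fin.sum_univ_two, mul_comm]
  apply ofReal_injective
  rw [h, h, hillTransform, star_mulVec, ← dotProduct_mulVec, mulVec_mulVec,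
    mem_subgroupSU2_iff.1 hB, one_mulVec]

theorem hillPotential_hillTransform_inv_congr {A B : SL(2, ℂ)} (h : A⁻¹ * B ∈ subgroupSU2)
    (w : ℂ → Fin 2 → ℂ) :
    hillPotential (hillTransform A⁻¹ w) = hillPotential (hillTransform B⁻¹ w) := by
  have : hillTransform A⁻¹ w = hillTransform (A⁻¹ * B) (hillTransform B⁻¹ w) := by
    rw [← hillTransform_mul, mul_assoc, mul_inv_cancel, mul_one]
  funext z
  rw [hillPotential, hillPotential, this, hillNormSq_hillTransform_of_mem h]

namespace IsHillPair

variable {V : Set ℂ} {ρ : ℂ → ℂ} {w : ℂ → Fin 2 → ℂ}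

theorem deriv_hillTransform (hw : IsHillPair V ρ w) (hVo : IsOpen V) (B : SL(2, ℂ)) {z : ℂ}
    (hz : z ∈ V) (i : Fin 2) :
    deriv (fun p => hillTransform B w p i) z
      = B i 0 * deriv (fun p => w p 0) z + B i 1 * deriv (fun p => w p 1) z := by
  simp only [hillTransform_apply]
  exact (((hw.hasDerivAt hVo 0 hz).const_mul _).fun_add
    ((hw.hasDerivAt hVo 1 hz).const_mul _)).deriv

theorem transform (hw : IsHillPair V ρ w) (hVo : IsOpen V) (B : SL(2, ℂ)) :
    IsHillPair V ρ (hillTransform B w) := by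
  refine ⟨fun i => ?_, fun i z hz => ?_, fun z hz => ?_⟩
  · simp only [hillTransform_apply]
    exact ((hw.holomorphic 0).const_mul _).add ((hw.holomorphic 1).const_mul _)
  · have h1 : (deriv fun p => hillTransform B w p i) =ᶠ[nhds z] fun z =>
        B i 0 * deriv (fun p => w p 0) z + B i 1 * deriv (fun p => w p 1) z := by
      filter_upwards [hVo.mem_nhds hz] with t ht using hw.deriv_hillTransform hVo B ht i
    have h2 := (((hw.hasDerivAt_deriv hVo 0 hz).const_mul (B i 0)).fun_add
      ((hw.hasDerivAt_deriv hVo 1 hz).const_mul (B i 1))).deriv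
    rw [h1.deriv_eq, h2, hillTransform_apply]
    ring
  · rw [hw.deriv_hillTransform hVo B hz, hw.deriv_hillTransform hVo B hz, hillTransform_apply,
      hillTransform_apply]
    linear_combination (w z 0 * deriv (fun p => w p 1) z - w z 1 * deriv (fun p => w p 0) z)
      * det_SL2 B + hw.wronskian z hz

/-! ### The solution space as `SL(2, ℂ) / SU(2)` -/

/-- The values of `u_w` and `∂u_w/∂z` at one point determine the Gram matrix of `(w, w')` there:
its last entry comes from `|w|² |w'|² = |⟨w', w⟩|² + 1/4`. So `B` preserves that Gram matrix. -/
theorem mem_subgroupSU2_of_eq_at (hw : IsHillPair V ρ w) (hVo : IsOpen V) {B : SL(2, ℂ)} {z : ℂ}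
    (hz : z ∈ V) (h0 : hillPotential (hillTransform B w) z = hillPotential w z)
    (h1 : hillLogDeriv (hillTransform B w) z = hillLogDeriv w z) : B ∈ subgroupSU2 := by
  have hw' := hw.transform hVo B
  have hN : hillNormSq (hillTransform B w) z = hillNormSq w z :=
    Real.log_injOn_pos (hw'.hillNormSq_pos hz) (hw.hillNormSq_pos hz) h0
  have hN0 : (hillNormSq w z : ℂ) ≠ 0 := by exact_mod_cast (hw.hillNormSq_pos hz).ne'
  rw [hillLogDeriv, hillLogDeriv, hN, mul_left_inj' (inv_ne_zero hN0)] at h1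
  have hW := hw.wronskian z hz
  have hWs := congrArg star hW
  have hW' := hw'.wronskian z hz
  have hWs' := congrArg star hW'
  have hNc := congrArg (fun x : ℝ => (x : ℂ)) hN
  simp only [ofReal_hillNormSq] at hNc hN0
  set W : Matrix (Fin 2) (Fin 2) ℂ :=
    !![w z 0, deriv (fun p => w p 0) z; w z 1, deriv (fun p => w p 1) z] with hWdef
  have hBW : (B : Matrix (Fin 2) (Fin 2) ℂ) * W =
      !![hillTransform B w z 0, deriv (fun p => hillTransform B w p 0) z;
        hillTransform B w z 1, deriv (fun p => hillTransform B w p 1) z] := by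
    rw [hw.deriv_hillTransform hVo B hz, hw.deriv_hillTransform hVo B hz, hillTransform_apply,
      hillTransform_apply]
    ext i j
    fin_cases i <;> fin_cases j <;> simp [W, Matrix.mul_apply, Fin.sum_univ_two]
  generalize hillTransform B w z 0 = a at *
  generalize hillTransform B w z 1 = b at *
  generalize deriv (fun p => hillTransform B w p 0) z = c at *
  generalize deriv (fun p => hillTransform B w p 1) z = d at *
  generalize w z 0 = a' at *
  generalize w z 1 = b' at *
  generalize deriv (fun p => w p 0) z = c' at *
  generalize deriv (fun p => w p 1) z = d' at *
  simp only [star_sub, star_mul', star_div₀, star_one, star_ofNat] at hWs hWs'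
  have h1s := congrArg star h1
  simp only [star_add, star_mul', star_star] at h1s
  -- `|w|² |w'|² - |⟨w', w⟩|²` is the square of the absolute value of the Wronskian
  have hd : c * star c + d * star d = c' * star c' + d' * star d' := by
    refine mul_left_cancel₀ hN0 ?_
    linear_combination (-(c * star c + d * star d)) * hNc
      + (star c * a + star d * b) * h1 + (c' * star a' + d' * star b') * h1s
      + (star a * star d - star b * star c) * hW' - (star a' * star d' - star b' * star c') * hW
      + hWs' / 2 - hWs / 2
  have hGram : (W)ᴴ * ((B : Matrix (Fin 2) (Fin 2) ℂ)ᴴ * B) * W = Wᴴ * 1 * W := by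
    have : (W)ᴴ * ((B : Matrix (Fin 2) (Fin 2) ℂ)ᴴ * B) * W
        = ((B : Matrix (Fin 2) (Fin 2) ℂ) * W)ᴴ * ((B : Matrix (Fin 2) (Fin 2) ℂ) * W) := by
      simp only [conjTranspose_mul, Matrix.mul_assoc]
    rw [this, hBW, Matrix.mul_one, hWdef]
    ext i j
    fin_cases i <;> fin_cases j <;>
      simp only [Matrix.mul_apply, Fin.sum_univ_two, conjTranspose_apply, of_apply, cons_val',
        cons_val_zero, cons_val_one, cons_val_fin_one, Fin.zero_eta, Fin.mk_one]
    · linear_combination hNc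
    · linear_combination h1
    · linear_combination h1s
    · linear_combination hd
  have hdet : IsUnit W := by
    rw [isUnit_iff_isUnit_det, isUnit_iff_ne_zero, hWdef, det_fin_two_of]
    intro h
    rw [show a' * d' - c' * b' = 1 / 2 by linear_combination hW] at h
    norm_num at h
  exact mem_subgroupSU2_iff.2 ((hdet.star.mul_left_cancel (hdet.mul_right_cancel hGram)))

end IsHillPair

/-- The matrix `B` for which `B⁻¹ (w, w')` at `z` is the upper triangular matrix with columns
`(e^{t/2}, 0)` and `(c e^{t/2}, e^{-t/2}/2)`; for it `u = t` and `∂u/∂z = c` at `z`. -/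
noncomputable def hillSection (w : ℂ → Fin 2 → ℂ) (z : ℂ) (x : ℝ × ℂ) :
    Matrix (Fin 2) (Fin 2) ℂ :=
  of fun i => ![w z i * (Real.exp (-(x.1 / 2)) : ℝ),
    2 * (deriv (fun p => w p i) z - w z i * x.2) * (Real.exp (x.1 / 2) : ℝ)]

namespace IsHillPair

variable {V : Set ℂ} {ρ : ℂ → ℂ} {w : ℂ → Fin 2 → ℂ}

theorem det_hillSection (hw : IsHillPair V ρ w) {z : ℂ} (hz : z ∈ V) (x : ℝ × ℂ) :
    (hillSection w z x).det = 1 := by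
  have he : ((Real.exp (-(x.1 / 2)) : ℝ) : ℂ) * (Real.exp (x.1 / 2) : ℝ) = 1 := by
    rw [← ofReal_mul, ← Real.exp_add]
    simp
  rw [det_fin_two]
  simp only [hillSection, of_apply, cons_val_zero, cons_val_one]
  linear_combination 2 * (w z 0 * deriv (fun p => w p 1) z - w z 1 * deriv (fun p => w p 0) z) * he
    + 2 * hw.wronskian z hz

theorem hillPotential_hillSection (hw : IsHillPair V ρ w) (hVo : IsOpen V) {z : ℂ} (hz : z ∈ V)
    (x : ℝ × ℂ) :
    hillPotential (hillTransform (⟨hillSection w z x, hw.det_hillSection hz x⟩ : SL(2, ℂ))⁻¹ w) z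
        = x.1 ∧
    hillLogDeriv (hillTransform (⟨hillSection w z x, hw.det_hillSection hz x⟩ : SL(2, ℂ))⁻¹ w) z
        = x.2 := by
  set B : SL(2, ℂ) := ⟨hillSection w z x, hw.det_hillSection hz x⟩ with hB
  have hW := hw.wronskian z hz
  have hinv : ((B⁻¹ : SL(2, ℂ)) : Matrix (Fin 2) (Fin 2) ℂ)
      = !![B 1 1, -B 0 1; -B 1 0, B 0 0] :=
    (Matrix.SpecialLinearGroup.coe_inv B).trans (adjugate_fin_two _)
  have e0 : hillTransform B⁻¹ w z 0 = (Real.exp (x.1 / 2) : ℝ) := by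
    rw [hillTransform_apply, hinv]
    simp only [hB, hillSection, of_apply, cons_val', cons_val_zero, cons_val_one,
      cons_val_fin_one]
    linear_combination 2 * (Real.exp (x.1 / 2) : ℂ) * hW
  have e1 : hillTransform B⁻¹ w z 1 = 0 := by
    rw [hillTransform_apply, hinv]
    simp only [hB, hillSection, of_apply, cons_val', cons_val_zero, cons_val_one,
      cons_val_fin_one]
    ring
  have d0 : deriv (fun p => hillTransform B⁻¹ w p 0) z = x.2 * (Real.exp (x.1 / 2) : ℝ) := by
    rw [hw.deriv_hillTransform hVo _ hz, hinv]
    simp only [hB, hillSection, of_apply, cons_val', cons_val_zero, cons_val_one,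
      cons_val_fin_one]
    linear_combination 2 * x.2 * (Real.exp (x.1 / 2) : ℂ) * hW
  have hN : hillNormSq (hillTransform B⁻¹ w) z = Real.exp x.1 := by
    rw [hillNormSq, e0, e1, norm_real, Real.norm_of_nonneg (Real.exp_pos _).le, norm_zero, sq,
      ← Real.exp_add]
    ring_nf
  refine ⟨by rw [hillPotential, hN, Real.log_exp], ?_⟩
  have hne : ((Real.exp x.1 : ℝ) : ℂ) ≠ 0 := by exact_mod_cast (Real.exp_pos _).ne'
  rw [hillLogDeriv, hN, e0, e1, d0, mul_inv_eq_iff_eq_mul₀ hne]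
  simp only [star_zero, mul_zero, add_zero, RCLike.star_def, conj_ofReal]
  rw [mul_assoc, ← ofReal_mul, ← Real.exp_add]
  ring_nf

theorem wirtingerZ_hillPotential (hw : IsHillPair V ρ w) (hVo : IsOpen V) {z : ℂ} (hz : z ∈ V) :
    wirtingerZ (fun p => (hillPotential w p : ℂ)) z = hillLogDeriv w z :=
  (hw.hasWirtingerAt_hillPotential hVo hz).wirtingerZ_eq

theorem inv_mul_mem_subgroupSU2 (hw : IsHillPair V ρ w) (hVo : IsOpen V) {z : ℂ} (hz : z ∈ V)
    {A B : SL(2, ℂ)}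
    (h0 : hillPotential (hillTransform A⁻¹ w) z = hillPotential (hillTransform B⁻¹ w) z)
    (h1 : wirtingerZ (fun p => (hillPotential (hillTransform A⁻¹ w) p : ℂ)) z
      = wirtingerZ (fun p => (hillPotential (hillTransform B⁻¹ w) p : ℂ)) z) :
    A⁻¹ * B ∈ subgroupSU2 := by
  have hA : hillTransform A⁻¹ w = hillTransform (A⁻¹ * B) (hillTransform B⁻¹ w) := by
    rw [← hillTransform_mul, mul_assoc, mul_inv_cancel, mul_one]
  rw [(hw.transform hVo _).wirtingerZ_hillPotential hVo hz,
    (hw.transform hVo _).wirtingerZ_hillPotential hVo hz] at h1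
  rw [hA] at h0 h1
  exact (hw.transform hVo _).mem_subgroupSU2_of_eq_at hVo hz h0 h1

/-- The pair `(u_{B⁻¹w}, ∂u_{B⁻¹w}/∂z)` at `z` depends only on the coset of `B`, it separates
cosets, and `hillSection` gives a continuous inverse. -/
theorem exists_homeomorph (hw : IsHillPair V ρ w) (hVo : IsOpen V) {z : ℂ} (hz : z ∈ V) :
    ∃ Ψ : (SL(2, ℂ) ⧸ subgroupSU2) ≃ₜ ℝ × ℂ, ∀ B : SL(2, ℂ), Ψ (QuotientGroup.mk B) =
      (hillPotential (hillTransform B⁻¹ w) z,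
        wirtingerZ (fun p => (hillPotential (hillTransform B⁻¹ w) p : ℂ)) z) := by
  let φ : SL(2, ℂ) → ℝ × ℂ := fun B => (hillPotential (hillTransform B⁻¹ w) z,
    wirtingerZ (fun p => (hillPotential (hillTransform B⁻¹ w) p : ℂ)) z)
  have hφ : ∀ A B : SL(2, ℂ), A⁻¹ * B ∈ subgroupSU2 ↔ φ A = φ B := by
    refine fun A B => ⟨fun h => ?_, fun h => ?_⟩
    · simp only [φ, hillPotential_hillTransform_inv_congr h]
    · exact hw.inv_mul_mem_subgroupSU2 hVo hz (congrArg Prod.fst h) (congrArg Prod.snd h)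
  let T : ℝ × ℂ → SL(2, ℂ) := fun x => ⟨hillSection w z x, hw.det_hillSection hz x⟩
  have hT : ∀ x, φ (T x) = x := by
    intro x
    obtain ⟨h1, h2⟩ := hw.hillPotential_hillSection hVo hz x
    refine Prod.ext h1 ?_
    simp only [φ]
    rw [(hw.transform hVo _).wirtingerZ_hillPotential hVo hz]
    exact h2
  have hTc : Continuous T := by
    refine Continuous.subtype_mk (continuous_matrix fun i j => ?_) _
    fin_cases j
    · simp only [hillSection, of_apply, Fin.zero_eta, cons_val_zero]
      fun_prop
    · simp only [hillSection, of_apply, Fin.mk_one, cons_val_one]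
      fun_prop
  have hφc : Continuous φ := by
    have hc : ∀ i j, Continuous fun B : SL(2, ℂ) => B⁻¹ i j := fun i j =>
      (continuous_subtype_val.comp (continuous_inv (G := SL(2, ℂ)))).matrix_elem i j
    have hv : ∀ i, Continuous fun B : SL(2, ℂ) => hillTransform B⁻¹ w z i := fun i => by
      simp only [hillTransform_apply]
      exact ((hc i 0).mul continuous_const).add ((hc i 1).mul continuous_const)
    have hN : Continuous fun B : SL(2, ℂ) => hillNormSq (hillTransform B⁻¹ w) z :=
      ((hv 0).norm.pow 2).add ((hv 1).norm.pow 2)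
    have hN0 : ∀ B : SL(2, ℂ), hillNormSq (hillTransform B⁻¹ w) z ≠ 0 := fun B =>
      ((hw.transform hVo _).hillNormSq_pos hz).ne'
    refine Continuous.prodMk (hN.log hN0) ?_
    have hd : ∀ i, Continuous fun B : SL(2, ℂ) =>
        deriv (fun p => hillTransform B⁻¹ w p i) z := fun i => by
      simp only [hw.deriv_hillTransform hVo _ hz]
      exact ((hc i 0).mul continuous_const).add ((hc i 1).mul continuous_const)
    simp only [(hw.transform hVo _).wirtingerZ_hillPotential hVo hz, hillLogDeriv]
    refine (((hd 0).mul (hv 0).star).add ((hd 1).mul (hv 1).star)).mul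
      ((continuous_ofReal.comp hN).inv₀ fun B => ?_)
    exact ofReal_ne_zero.2 (hN0 B)
  refine ⟨{
    toFun := Quotient.lift φ fun A B h => (hφ A B).1 (QuotientGroup.leftRel_apply.1 h)
    invFun := fun x => QuotientGroup.mk (T x)
    left_inv := ?_
    right_inv := hT
    continuous_toFun := hφc.quotient_lift _
    continuous_invFun := QuotientGroup.continuous_mk.comp hTc }, fun B => rfl⟩
  intro q
  induction q using QuotientGroup.induction_on with
  | H B => exact QuotientGroup.eq.2 ((hφ _ _).2 (hT (φ B)))

/-- Every solution is `u_{B⁻¹w}` for some `B`: choose `B` so that the two functions and their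
`z`-derivatives agree at one point. -/
theorem exists_hillTransform (hw : IsHillPair V ρ w) (hVo : IsOpen V) (hV : IsConnected V)
    {u : ℂ → ℝ} (hu : IsLiouvilleSolution V ρ u) :
    ∃ B : SL(2, ℂ), ∀ z ∈ V, u z = hillPotential (hillTransform B⁻¹ w) z := by
  obtain ⟨z₀, hz₀⟩ := hV.nonempty
  obtain ⟨Ψ, hΨ⟩ := hw.exists_homeomorph hVo hz₀
  obtain ⟨q, hq⟩ := Ψ.surjective (u z₀, wirtingerZ (fun p => (u p : ℂ)) z₀)
  induction q using QuotientGroup.induction_on with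
  | H B =>
    rw [hΨ] at hq
    exact ⟨B, hu.eqOn_of_eq_at hVo hV.isPreconnected hw
      ((hw.transform hVo _).isLiouvilleSolution hVo) hz₀ (congrArg Prod.fst hq).symm
      (congrArg Prod.snd hq).symm⟩

theorem exists_equiv_liouvilleSolutions (hw : IsHillPair V ρ w) (hVo : IsOpen V)
    (hV : IsConnected V) :
    ∃ Φ : (SL(2, ℂ) ⧸ subgroupSU2) ≃ liouvilleSolutions V ρ, ∀ (B : SL(2, ℂ)) (z : V),
      (Φ (QuotientGroup.mk B) : V → ℝ) z = hillPotential (hillTransform B⁻¹ w) z := by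
  obtain ⟨z₀, hz₀⟩ := hV.nonempty
  let φ : SL(2, ℂ) → liouvilleSolutions V ρ := fun B =>
    ⟨fun z => hillPotential (hillTransform B⁻¹ w) z, _,
      (hw.transform hVo _).isLiouvilleSolution hVo, fun _ => rfl⟩
  have hφ : ∀ A B : SL(2, ℂ), A⁻¹ * B ∈ subgroupSU2 → φ A = φ B := fun A B h => by
    simp only [φ, hillPotential_hillTransform_inv_congr h]
  refine ⟨Equiv.ofBijective (Quotient.lift φ fun A B h =>
    hφ A B (QuotientGroup.leftRel_apply.1 h)) ⟨?_, ?_⟩, fun B z => rfl⟩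
  · intro q q'
    induction q using QuotientGroup.induction_on with
    | H A =>
    induction q' using QuotientGroup.induction_on with
    | H B =>
    intro h
    have hAB : ∀ z ∈ V, hillPotential (hillTransform A⁻¹ w) z
        = hillPotential (hillTransform B⁻¹ w) z := fun z hz =>
      congrFun (congrArg Subtype.val h) ⟨z, hz⟩
    refine QuotientGroup.eq.2 (hw.inv_mul_mem_subgroupSU2 hVo hz₀ (hAB z₀ hz₀) ?_)
    have : (fun p => (hillPotential (hillTransform A⁻¹ w) p : ℂ)) =ᶠ[nhds z₀]
        fun p => (hillPotential (hillTransform B⁻¹ w) p : ℂ) := by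
      filter_upwards [hVo.mem_nhds hz₀] with p hp
      rw [hAB p hp]
    rw [wirtingerZ, wirtingerZ, this.fderiv_eq]
  · rintro ⟨f, u, hu, hf⟩
    obtain ⟨B, hB⟩ := hw.exists_hillTransform hVo hV hu
    refine ⟨QuotientGroup.mk B, Subtype.ext (funext fun z => ?_)⟩
    exact (hB z z.2).symm.trans (hf z).symm

end IsHillPair

/-! ### Conformal metrics -/

theorem partialD_congr {E : Type*} [NormedAddCommGroup E] [NormedSpace ℝ E] {f f' : ℂ → E}
    {p : ℂ} (h : f =ᶠ[nhds p] f') (i : Fin 2) : partialD i f p = partialD i f' p := by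
  rw [partialD, partialD, h.fderiv_eq]

theorem partialD_neg (i : Fin 2) (f : ℂ → ℝ) (p : ℂ) :
    partialD i (fun q => -f q) p = -partialD i f p := by
  simp [partialD]

theorem partialD_const_mul (i : Fin 2) (c : ℝ) (f : ℂ → ℝ) (p : ℂ) :
    partialD i (fun q => c * f q) p = c * partialD i f p := by
  have h : (fun q => c * f q) = c • f := rfl
  rw [partialD, partialD, h, fderiv_const_smul_field]
  rfl

theorem dzNormSq_eq_one : dzNormSq = 1 := by
  ext i j
  fin_cases i <;> fin_cases j <;> simp [dzNormSq, coordVec]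

theorem inv_smul_one {c : ℝ} (hc : c ≠ 0) :
    (c • (1 : Matrix (Fin 2) (Fin 2) ℝ))⁻¹ = c⁻¹ • 1 := by
  refine inv_eq_right_inv ?_
  simp [hc]

theorem metricTrace_of_eq_smul_one {g h : ℂ → Matrix (Fin 2) (Fin 2) ℝ} {p : ℂ} {c : ℝ}
    (hc : c ≠ 0) (hg : g p = c • 1) : metricTrace g h p = c⁻¹ * (h p 0 0 + h p 1 1) := by
  rw [metricTrace, hg, inv_smul_one hc]
  simp [Fin.sum_univ_two]
  ring

theorem traceFreePart_of_eq_smul_one {g h : ℂ → Matrix (Fin 2) (Fin 2) ℝ} {p : ℂ} {c : ℝ}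
    (hc : c ≠ 0) (hg : g p = c • 1) :
    traceFreePart g h p = h p - ((h p 0 0 + h p 1 1) / 2) • 1 := by
  rw [traceFreePart, metricTrace_of_eq_smul_one hc hg, hg, smul_smul]
  congr 2
  field_simp

theorem quadraticDifferential_of_eq_smul_one {g h : ℂ → Matrix (Fin 2) (Fin 2) ℝ} {p : ℂ} {c : ℝ}
    (hc : 0 < c) (hg : g p = c • 1) :
    quadraticDifferential g h p = !![h p 0 0 - I * h p 1 0, h p 0 1 - I * h p 1 1;
      h p 1 0 + I * h p 0 0, h p 1 1 + I * h p 0 1] := by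
  have hJ : complexStructure g p = !![0, -1; 1, 0] := by
    rw [complexStructure, hg]
    have hs : Real.sqrt (c • (1 : Matrix (Fin 2) (Fin 2) ℝ)).det = c := by
      rw [det_fin_two]
      simp [hc.le]
    rw [hs]
    ext i j
    fin_cases i <;> fin_cases j <;> simp [hc.ne']
  ext i j
  fin_cases i <;> fin_cases j <;> simp [quadraticDifferential, hJ, Fin.sum_univ_two]

section Conformal

variable {V : Set ℂ} {v : ℂ → ℝ} {g : ℂ → Matrix (Fin 2) (Fin 2) ℝ}

theorem christoffel_conformal (hVo : IsOpen V) (hv : DifferentiableOn ℝ v V)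
    (hg : ∀ p ∈ V, g p = Real.exp (2 * v p) • 1) {p : ℂ} (hp : p ∈ V) (k i j : Fin 2) :
    christoffel g k i j p = (if k = j then partialD i v p else 0)
      + (if k = i then partialD j v p else 0) - (if i = j then partialD k v p else 0) := by
  have hd : ∀ i j l, partialD i (fun q => g q j l) p
      = if j = l then 2 * Real.exp (2 * v p) * partialD i v p else 0 := by
    intro i j l
    have h1 : (fun q => g q j l) =ᶠ[nhds p]
        fun q => Real.exp (2 * v q) * (if j = l then 1 else 0) := by
      filter_upwards [hVo.mem_nhds hp] with q hq
      rw [hg q hq, Matrix.smul_apply, one_apply, smul_eq_mul]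
    rw [partialD_congr h1]
    have h2 := (hv.differentiableAt (hVo.mem_nhds hp)).hasFDerivAt
    have h3 := (((h2.const_mul 2).exp).mul_const (if j = l then (1 : ℝ) else 0)).fderiv
    rw [partialD, h3]
    split_ifs <;> simp [partialD]
    ring
  have hexp := (Real.exp_pos (2 * v p)).ne'
  simp only [christoffel, hd, hg p hp, inv_smul_one hexp, Fin.sum_univ_two]
  fin_cases k <;> fin_cases i <;> fin_cases j <;> simp <;> field_simp

/-- The Gauss curvature of `e^{2v} |dz|²` is `-e^{-2v} Δv`. -/
theorem gaussCurvature_conformal (hVo : IsOpen V) (hv : DifferentiableOn ℝ v V)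
    (hg : ∀ p ∈ V, g p = Real.exp (2 * v p) • 1) {p : ℂ} (hp : p ∈ V) :
    gaussCurvature g p = -(partialD 0 (partialD 0 v) p + partialD 1 (partialD 1 v) p)
      * Real.exp (-(2 * v p)) := by
  have hΓ : ∀ k i j : Fin 2, christoffel g k i j =ᶠ[nhds p] fun p =>
      (if k = j then partialD i v p else 0)
      + (if k = i then partialD j v p else 0) - (if i = j then partialD k v p else 0) := by
    intro k i j
    filter_upwards [hVo.mem_nhds hp] with q hq using christoffel_conformal hVo hv hg hq k i j
  have h0 : partialD 0 (christoffel g 0 1 1) p = -partialD 0 (partialD 0 v) p := by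
    rw [partialD_congr (hΓ 0 1 1)]
    simpa using partialD_neg 0 (partialD 0 v) p
  have h1 : partialD 1 (christoffel g 0 0 1) p = partialD 1 (partialD 1 v) p := by
    rw [partialD_congr (hΓ 0 0 1)]
    simp
  have hR : riemannTensor g 0 1 1 0 p
      = -(partialD 0 (partialD 0 v) p + partialD 1 (partialD 1 v) p) := by
    rw [riemannTensor, h0, h1]
    simp only [christoffel_conformal hVo hv hg hp, Fin.sum_univ_two]
    simp
    ring
  have hexp := (Real.exp_pos (2 * v p)).ne'
  rw [gaussCurvature, hg p hp, Fin.sum_univ_two, hR, det_fin_two, Real.exp_neg]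
  simp
  field_simp

theorem hessian_conformal (hVo : IsOpen V) (hv : DifferentiableOn ℝ v V)
    (hg : ∀ p ∈ V, g p = Real.exp (2 * v p) • 1) {p : ℂ} (hp : p ∈ V) (f : ℂ → ℝ) :
    hessian g f p =
      !![partialD 0 (partialD 0 f) p - (partialD 0 v p * partialD 0 f p
            - partialD 1 v p * partialD 1 f p),
          partialD 0 (partialD 1 f) p - (partialD 1 v p * partialD 0 f p
            + partialD 0 v p * partialD 1 f p);
        partialD 1 (partialD 0 f) p - (partialD 1 v p * partialD 0 f p
            + partialD 0 v p * partialD 1 f p),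
          partialD 1 (partialD 1 f) p - (partialD 1 v p * partialD 1 f p
            - partialD 0 v p * partialD 0 f p)] := by
  ext i j
  simp only [hessian, of_apply, christoffel_conformal hVo hv hg hp, Fin.sum_univ_two]
  fin_cases i <;> fin_cases j <;> simp
  all_goals ring

end Conformal

/-! ### The entropy differential of `e^{2u} |dz|²` -/

/-- The system for `u` in terms of real second derivatives. -/
theorem IsLiouvilleSolution.partialD_partialD {V : Set ℂ} (hVo : IsOpen V) {ρ : ℂ → ℂ} {u : ℂ → ℝ}
    (hu : IsLiouvilleSolution V ρ u) {z : ℂ} (hz : z ∈ V) :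
    partialD 0 (partialD 0 u) z + partialD 1 (partialD 1 u) z = Real.exp (-2 * u z) ∧
    partialD 0 (partialD 0 u) z - partialD 1 (partialD 1 u) z
      = -(ρ z).re - partialD 0 u z ^ 2 + partialD 1 u z ^ 2 ∧
    partialD 0 (partialD 1 u) z = (ρ z).im / 2 - partialD 0 u z * partialD 1 u z ∧
    partialD 1 (partialD 0 u) z = (ρ z).im / 2 - partialD 0 u z * partialD 1 u z := by
  have hd : ∀ p ∈ V, DifferentiableAt ℝ u p := fun p hp =>
    (hu.smooth.contDiffAt (hVo.mem_nhds hp)).differentiableAt (by simp)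
  obtain ⟨-, hU⟩ := hu.hasWirtingerAt hVo hz
  set U := wirtingerZ (fun p => (u p : ℂ)) with hUdef
  have hUeq : ∀ p ∈ V, U p = ((partialD 0 u p : ℝ) - I * (partialD 1 u p : ℝ)) / 2 := by
    intro p hp
    rw [hUdef, wirtingerZ, fderiv_ofReal_comp (hd p hp), fderiv_ofReal_comp (hd p hp)]
    rfl
  have h0 : partialD 0 u =ᶠ[nhds z] fun p => 2 * (U p).re := by
    filter_upwards [hVo.mem_nhds hz] with p hp
    rw [hUeq p hp]
    simp
    ring
  have h1 : partialD 1 u =ᶠ[nhds z] fun p => -2 * (U p).im := by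
    filter_upwards [hVo.mem_nhds hz] with p hp
    rw [hUeq p hp]
    simp
    ring
  have hUd : HasFDerivAt U (fderiv ℝ U z) z := (HasFDerivAt.differentiableAt hU).hasFDerivAt
  have hre : ∀ i, partialD i (partialD 0 u) z = 2 * (fderiv ℝ U z (coordVec i)).re := by
    intro i
    have h : HasFDerivAt (fun p => (U p).re) _ z := reCLM.hasFDerivAt.comp z hUd
    rw [partialD_congr h0, partialD_const_mul, partialD, h.fderiv]
    simp
  have him : ∀ i, partialD i (partialD 1 u) z = -2 * (fderiv ℝ U z (coordVec i)).im := by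
    intro i
    have h : HasFDerivAt (fun p => (U p).im) _ z := imCLM.hasFDerivAt.comp z hUd
    rw [partialD_congr h1, partialD_const_mul, partialD, h.fderiv]
    simp
  rw [hre, hre, him, him, hU.fderiv_apply, hU.fderiv_apply, hUeq z hz]
  simp only [coordVec, cons_val_zero, cons_val_one]
  refine ⟨?_, ?_, ?_, ?_⟩ <;> simp [sq, -ofReal_exp] <;> ring

/-- For `g = e^{2u} |dz|²` one has `K_g = -e^{-4u}`, the metric `|K_g|^{3/4} g` is `e^{-u} |dz|²`, of
curvature `e^{-u}/2`, and the trace-free Hessian of `-u` with respect to it is the real part of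
`-2 (u_zz + u_z²) dz² = (ρ/2) dz²`. -/
theorem IsLiouvilleSolution.entropyDifferential_eq {V : Set ℂ} (hVo : IsOpen V) {ρ : ℂ → ℂ}
    {u : ℂ → ℝ} (hu : IsLiouvilleSolution V ρ u) {g : ℂ → Matrix (Fin 2) (Fin 2) ℝ}
    (hg : ∀ p ∈ V, g p = Real.exp (2 * u p) • 1) {z : ℂ} (hz : z ∈ V) :
    gaussCurvature g z < 0 ∧ entropyDifferential g z = (ρ z / 2) • dzSq := by
  have hd : DifferentiableOn ℝ u V := hu.smooth.differentiableOn (by simp)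
  have hK : ∀ p ∈ V, gaussCurvature g p = -Real.exp (-4 * u p) := by
    intro p hp
    rw [gaussCurvature_conformal hVo hd hg hp, (hu.partialD_partialD hVo hp).1, neg_mul,
      ← Real.exp_add]
    ring_nf
  refine ⟨by rw [hK z hz]; exact neg_neg_of_pos (Real.exp_pos _), ?_⟩
  have hd' : DifferentiableOn ℝ (fun p => -(1 / 2) * u p) V := hd.const_mul _
  have hghat : ∀ p ∈ V, entropyMetric g p = Real.exp (2 * (-(1 / 2) * u p)) • 1 := by
    intro p hp
    rw [entropyMetric, hK p hp, hg p hp, abs_neg, abs_of_pos (Real.exp_pos _), ← Real.exp_mul,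
      smul_smul, ← Real.exp_add]
    ring_nf
  have hlin : ∀ i, partialD i (fun p => -(1 / 2) * u p) = fun p => -(1 / 2) * partialD i u p :=
    fun i => funext (partialD_const_mul i _ u)
  have hlog : ∀ p ∈ V, Real.log (gaussCurvature (entropyMetric g) p) = -u p - Real.log 2 := by
    intro p hp
    rw [gaussCurvature_conformal hVo hd' hghat hp, hlin, hlin, partialD_const_mul,
      partialD_const_mul, ← mul_add,
      (hu.partialD_partialD hVo hp).1]
    have : -(-(1 / 2) * Real.exp (-2 * u p)) * Real.exp (-(2 * (-(1 / 2) * u p)))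
        = Real.exp (-u p) / 2 := by
      have h : Real.exp (-2 * u p) * Real.exp (-(2 * (-(1 / 2) * u p))) = Real.exp (-u p) := by
        rw [← Real.exp_add]
        ring_nf
      linear_combination h / 2
    rw [this, Real.log_div (Real.exp_pos _).ne' two_ne_zero, Real.log_exp]
  set f := fun q => Real.log (gaussCurvature (entropyMetric g) q) with hf
  have hf1 : ∀ i, ∀ p ∈ V, partialD i f p = -partialD i u p := by
    intro i p hp
    have : f =ᶠ[nhds p] fun p => -u p - Real.log 2 := by
      filter_upwards [hVo.mem_nhds hp] with q hq using hlog q hq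
    rw [partialD_congr this, partialD, fderiv_sub_const]
    exact partialD_neg i u p
  have hf2 : ∀ i j, partialD i (partialD j f) z = -partialD i (partialD j u) z := by
    intro i j
    have : partialD j f =ᶠ[nhds z] fun p => -partialD j u p := by
      filter_upwards [hVo.mem_nhds hz] with q hq using hf1 j q hq
    rw [partialD_congr this, partialD_neg]
  obtain ⟨-, e1, e2, e3⟩ := hu.partialD_partialD hVo hz
  have hT : entropyForm g z = !![(ρ z).re / 2, -(ρ z).im / 2; -(ρ z).im / 2, -(ρ z).re / 2] := by
    rw [entropyForm, traceFreePart_of_eq_smul_one (Real.exp_pos _).ne' (hghat z hz),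
      ← hf, hessian_conformal hVo hd' hghat hz]
    simp only [hlin, hf1 _ z hz, hf2, e2, e3]
    ext i j
    fin_cases i <;> fin_cases j <;> simp
    · linear_combination -e1 / 2
    · ring
    · ring
    · linear_combination e1 / 2
  rw [entropyDifferential, quadraticDifferential_of_eq_smul_one (Real.exp_pos _) (hg z hz), hT]
  have hρ : ρ z = (ρ z).re + (ρ z).im * I := (re_add_im _).symm
  ext i j
  fin_cases i <;> fin_cases j <;> simp [dzSq, coordVec]
  · linear_combination -hρ / 2
  · linear_combination -I * hρ / 2 - (ρ z).im / 2 * I_sq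
  · linear_combination -I * hρ / 2 - (ρ z).im / 2 * I_sq
  · linear_combination hρ / 2

/-! ### The Weierstrass representation -/

theorem partialD_toLp_re {n : ℕ} {G : Fin n → ℂ → ℂ} {G' : Fin n → ℂ} {z : ℂ}
    (hG : ∀ k, HasDerivAt (G k) (G' k) z) (i : Fin 2) :
    partialD i (fun q => (WithLp.toLp 2 fun k => (G k q).re : EuclideanSpace ℝ (Fin n))) z
      = WithLp.toLp 2 fun k => (G' k * coordVec i).re := by
  have h : ∀ k, HasFDerivAt (fun q => (G k q).re)
      (reCLM.comp ((ContinuousLinearMap.toSpanSingleton ℂ (G' k)).restrictScalars ℝ)) z :=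
    fun k => reCLM.hasFDerivAt.comp z ((hG k).hasFDerivAt.restrictScalars ℝ)
  have h2 := (EuclideanSpace.equiv (Fin n) ℝ).symm.hasFDerivAt.comp z (hasFDerivAt_pi.2 h)
  have h3 : fderiv ℝ (fun q => (WithLp.toLp 2 fun k => (G k q).re : EuclideanSpace ℝ (Fin n))) z
    = _ := h2.fderiv
  rw [partialD, h3]
  ext k
  simp [mul_comm]

/-- The isotropic vector `(b² - a², -i(a² + b²), -2ab)` whose real primitives give the immersion. -/
noncomputable def weierstrassForm (a b : ℂ) : Fin 3 → ℂ :=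
  ![b ^ 2 - a ^ 2, -I * (a ^ 2 + b ^ 2), -(2 * a * b)]

/-- The derivative of `weierstrassForm a b` in the direction `(a', b')`. -/
noncomputable def weierstrassFormDeriv (a b a' b' : ℂ) : Fin 3 → ℂ :=
  ![2 * b * b' - 2 * a * a', -I * (2 * a * a' + 2 * b * b'), -(2 * (a' * b + a * b'))]

/-- The multiple of the unit normal of length `|a|² + |b|²`. -/
noncomputable def weierstrassNormal (a b : ℂ) : Fin 3 → ℝ :=
  ![2 * (a * star b).re, -(2 * (a * star b).im), ‖b‖ ^ 2 - ‖a‖ ^ 2]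

theorem hasDerivAt_weierstrassForm {a b : ℂ → ℂ} {a' b' z : ℂ} (ha : HasDerivAt a a' z)
    (hb : HasDerivAt b b' z) (k : Fin 3) :
    HasDerivAt (fun z => weierstrassForm (a z) (b z) k)
      (weierstrassFormDeriv (a z) (b z) a' b' k) z := by
  fin_cases k
  · exact ((hb.fun_pow 2).fun_sub (ha.fun_pow 2)).congr_deriv (by simp [weierstrassFormDeriv])
  · exact (((ha.fun_pow 2).fun_add (hb.fun_pow 2)).const_mul (-I)).congr_deriv
      (by simp [weierstrassFormDeriv])
  · exact (((ha.const_mul 2).fun_mul hb).fun_neg).congr_deriv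
      (by simp [weierstrassFormDeriv]; ring)

theorem inner_weierstrassForm (a b : ℂ) (i j : Fin 2) :
    inner ℝ (WithLp.toLp 2 fun k => (weierstrassForm a b k * coordVec i).re :
        EuclideanSpace ℝ (Fin 3))
      (WithLp.toLp 2 fun k => (weierstrassForm a b k * coordVec j).re)
      = (((‖a‖ ^ 2 + ‖b‖ ^ 2) ^ 2 • (1 : Matrix (Fin 2) (Fin 2) ℝ)) i j) := by
  rw [PiLp.inner_apply, Fin.sum_univ_three, ← normSq_eq_norm_sq, ← normSq_eq_norm_sq, normSq_apply, normSq_apply]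
  fin_cases i <;> fin_cases j <;> simp [weierstrassForm, coordVec, sq] <;> ring

theorem crossProduct_weierstrassForm (a b : ℂ) :
    crossProduct (fun k => (weierstrassForm a b k * coordVec 0).re)
      (fun k => (weierstrassForm a b k * coordVec 1).re)
      = (‖a‖ ^ 2 + ‖b‖ ^ 2) • weierstrassNormal a b := by
  rw [cross_apply]
  ext k
  simp only [← normSq_eq_norm_sq, normSq_apply, weierstrassNormal]
  fin_cases k <;> simp [weierstrassForm, coordVec, sq] <;> ring

theorem norm_weierstrassNormal (a b : ℂ) :
    ‖(WithLp.toLp 2 (weierstrassNormal a b) : EuclideanSpace ℝ (Fin 3))‖ = ‖a‖ ^ 2 + ‖b‖ ^ 2 := by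
  rw [EuclideanSpace.norm_eq, Real.sqrt_eq_iff_mul_self_eq (by positivity) (by positivity),
    Fin.sum_univ_three]
  simp only [weierstrassNormal, ← normSq_eq_norm_sq, normSq_apply, Real.norm_eq_abs, sq_abs]
  simp
  ring

/-- The second fundamental form is the real part of `2 (ab' - a'b) dz²`. -/
theorem weierstrassFormDeriv_dotProduct {a b a' b' : ℂ} (h : a * b' - b * a' = 1 / 2) (c : ℂ) :
    ∑ k, weierstrassNormal a b k * (weierstrassFormDeriv a b a' b' k * c).re
      = (‖a‖ ^ 2 + ‖b‖ ^ 2) * c.re := by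
  have key : ∑ k, (weierstrassNormal a b k : ℂ) * (weierstrassFormDeriv a b a' b' k * c)
      = ((‖a‖ ^ 2 + ‖b‖ ^ 2 : ℝ) : ℂ) * c := by
    have e0 : ((2 * (a * star b).re : ℝ) : ℂ) = a * star b + star a * b := by
      rw [← add_conj]
      simp
    have e1 : ((-(2 * (a * star b).im) : ℝ) : ℂ) = I * (a * star b - star a * b) := by
      have h1 : a * star b - star a * b = (2 * (a * star b).im : ℝ) * I := by
        rw [← sub_conj]
        simp
      rw [h1]
      push_cast
      linear_combination (-(2 * ((a * star b).im : ℂ))) * I_mul_I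
    have hn : ∀ x : ℂ, ((‖x‖ ^ 2 : ℝ) : ℂ) = x * star x := fun x => by
      simp [mul_conj, normSq_eq_norm_sq]
    rw [Fin.sum_univ_three, ofReal_add, hn, hn]
    simp only [weierstrassNormal, weierstrassFormDeriv, cons_val_zero, cons_val_one, cons_val]
    rw [e0, e1, ofReal_sub, hn, hn]
    linear_combination 2 * (a * star a + b * star b) * c * h
      - (a * star b - star a * b) * (2 * a * a' + 2 * b * b') * c * I_mul_I
  have := congrArg re key
  rw [re_ofReal_mul, re_sum] at this
  simpa only [re_ofReal_mul] using this

section Immersion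

variable {V : Set ℂ} {ρ : ℂ → ℂ} {w : ℂ → Fin 2 → ℂ} {G : Fin 3 → ℂ → ℂ}

/-- The map `X = Re G`. -/
noncomputable def reMap (G : Fin 3 → ℂ → ℂ) (z : ℂ) : EuclideanSpace ℝ (Fin 3) :=
  WithLp.toLp 2 fun k => (G k z).re

theorem partialD_reMap {z : ℂ}
    (hG : ∀ k, HasDerivAt (G k) (weierstrassForm (w z 0) (w z 1) k) z) (i : Fin 2) :
    partialD i (reMap G) z
      = WithLp.toLp 2 fun k => (weierstrassForm (w z 0) (w z 1) k * coordVec i).re :=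
  partialD_toLp_re hG i

theorem partialD_partialD_reMap (hw : IsHillPair V ρ w) (hVo : IsOpen V)
    (hG : ∀ k, ∀ z ∈ V, HasDerivAt (G k) (weierstrassForm (w z 0) (w z 1) k) z) {z : ℂ}
    (hz : z ∈ V) (i j : Fin 2) :
    partialD i (partialD j (reMap G)) z
      = WithLp.toLp 2 fun k => (weierstrassFormDeriv (w z 0) (w z 1)
        (deriv (fun p => w p 0) z) (deriv (fun p => w p 1) z) k * (coordVec i * coordVec j)).re := by
  have h : partialD j (reMap G) =ᶠ[nhds z] fun z =>
      WithLp.toLp 2 fun k => (weierstrassForm (w z 0) (w z 1) k * coordVec j).re := by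
    filter_upwards [hVo.mem_nhds hz] with p hp using partialD_reMap (fun k => hG k p hp) j
  rw [partialD_congr h, partialD_toLp_re (fun k => (hasDerivAt_weierstrassForm
    (hw.hasDerivAt hVo 0 hz) (hw.hasDerivAt hVo 1 hz) k).mul_const (coordVec j))]
  congr 1
  funext k
  ring_nf

theorem firstFundamentalForm_reMap {z : ℂ}
    (hG : ∀ k, HasDerivAt (G k) (weierstrassForm (w z 0) (w z 1) k) z) :
    firstFundamentalForm (reMap G) z = (hillNormSq w z) ^ 2 • 1 := by
  ext i j
  rw [firstFundamentalForm, of_apply, partialD_reMap hG, partialD_reMap hG, inner_weierstrassForm,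
    hillNormSq]

theorem gaussMap_reMap (hw : IsHillPair V ρ w) {z : ℂ} (hz : z ∈ V)
    (hG : ∀ k, HasDerivAt (G k) (weierstrassForm (w z 0) (w z 1) k) z) :
    gaussMap (reMap G) z
      = (hillNormSq w z)⁻¹ • WithLp.toLp 2 (weierstrassNormal (w z 0) (w z 1)) := by
  have hN := hw.hillNormSq_pos hz
  rw [gaussMap, partialD_reMap hG, partialD_reMap hG, crossProduct_weierstrassForm,
    ← hillNormSq, WithLp.toLp_smul]
  simp only
  rw [norm_smul, norm_weierstrassNormal, ← hillNormSq, Real.norm_of_nonneg hN.le, smul_smul]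
  congr 1
  field_simp

theorem secondFundamentalForm_reMap (hw : IsHillPair V ρ w) (hVo : IsOpen V)
    (hG : ∀ k, ∀ z ∈ V, HasDerivAt (G k) (weierstrassForm (w z 0) (w z 1) k) z) {z : ℂ}
    (hz : z ∈ V) : secondFundamentalForm (reMap G) z = dzSq.map Complex.re := by
  have hN := hw.hillNormSq_pos hz
  ext i j
  rw [secondFundamentalForm, of_apply, partialD_partialD_reMap hw hVo hG hz,
    gaussMap_reMap hw hz fun k => hG k z hz, inner_smul_right, PiLp.inner_apply]
  have := weierstrassFormDeriv_dotProduct (hw.wronskian z hz) (coordVec i * coordVec j)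
  simp only [RCLike.inner_apply, conj_trivial]
  rw [this, ← hillNormSq, inv_mul_cancel_left₀ hN.ne']
  rfl

/-- For every pair `w` the Weierstrass representation gives a minimal immersion with metric
`|w|⁴ |dz|²` and second fundamental form `Re dz²`. -/
theorem IsHillPair.exists_isMinimalImmersion (hw : IsHillPair V ρ w) (hVo : IsOpen V)
    (hVs : IsSimplyConnected V) :
    ∃ X : ℂ → EuclideanSpace ℝ (Fin 3), IsMinimalImmersion V X ∧ ∀ z ∈ V,
      firstFundamentalForm X z = (hillNormSq w z) ^ 2 • 1 ∧
      secondFundamentalForm X z = dzSq.map Complex.re := by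
  have hprim : ∀ k, ∃ G : ℂ → ℂ, ∀ z ∈ V,
      HasDerivAt G (weierstrassForm (w z 0) (w z 1) k) z := fun k =>
    DifferentiableOn.isExactOn_of_isSimplyConnected hVo hVs fun z hz =>
      (hasDerivAt_weierstrassForm (hw.hasDerivAt hVo 0 hz) (hw.hasDerivAt hVo 1 hz)
        k).differentiableAt.differentiableWithinAt
  choose G hG using hprim
  have h1 : ∀ z ∈ V, firstFundamentalForm (reMap G) z = (hillNormSq w z) ^ 2 • 1 := fun z hz =>
    firstFundamentalForm_reMap fun k => hG k z hz
  have h2 : ∀ z ∈ V, secondFundamentalForm (reMap G) z = dzSq.map Complex.re := fun z hz =>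
    secondFundamentalForm_reMap hw hVo hG hz
  refine ⟨reMap G, ⟨?_, fun z hz => ?_, fun z hz => ?_⟩, fun z hz => ⟨h1 z hz, h2 z hz⟩⟩
  · refine contDiffOn_euclidean.2 fun k => ?_
    have : DifferentiableOn ℂ (G k) V := fun z hz =>
      (hG k z hz).differentiableAt.differentiableWithinAt
    exact reCLM.contDiff.comp_contDiffOn ((this.contDiffOn hVo).restrict_scalars ℝ)
  · have hN : hillNormSq w z ^ 2 ≠ 0 := (pow_pos (hw.hillNormSq_pos hz) 2).ne'
    refine (injective_iff_map_eq_zero _).2 fun v hv => ?_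
    have hvd : v.re • partialD 0 (reMap G) z + v.im • partialD 1 (reMap G) z = 0 := by
      rw [← hv, partialD, partialD, ← map_smul, ← map_smul, ← map_add]
      congr 1
      simp [coordVec]
    have hij : ∀ i j, inner ℝ (partialD i (reMap G) z) (partialD j (reMap G) z)
        = (hillNormSq w z ^ 2 • (1 : Matrix (Fin 2) (Fin 2) ℝ)) i j := fun i j => by
      rw [← h1 z hz, firstFundamentalForm, of_apply]
    have hi : ∀ i, inner ℝ (partialD i (reMap G) z)
        (v.re • partialD 0 (reMap G) z + v.im • partialD 1 (reMap G) z) = 0 := fun i => by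
      rw [hvd, inner_zero_right]
    simp only [inner_add_right, inner_smul_right, hij] at hi
    have h0 := hi 0
    have h1 := hi 1
    simp only [Matrix.smul_apply, one_apply, smul_eq_mul] at h0 h1
    simp [hN] at h0 h1
    exact Complex.ext h0 h1
  · rw [meanCurvature, metricTrace_of_eq_smul_one (pow_pos (hw.hillNormSq_pos hz) 2).ne' (h1 z hz),
      h2 z hz]
    simp [dzSq, coordVec]

end Immersion

theorem mainTheorem5 (V : Set ℂ) (hVo : IsOpen V) (hVs : IsSimplyConnected V)
    (ρ : ℂ → ℂ) (hρ : DifferentiableOn ℂ ρ V) :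
    -- the solutions `u` are exactly the functions `log |w|²`
    (∀ u : ℂ → ℝ, IsLiouvilleSolution V ρ u ↔
      ∃ w : ℂ → Fin 2 → ℂ, IsHillPair V ρ w ∧ ∀ z ∈ V, u z = hillPotential w z) ∧
    -- the solutions form the three-dimensional space `SL(2, ℂ) / SU(2)`
    (∃ w : ℂ → Fin 2 → ℂ, IsHillPair V ρ w) ∧
    (∀ w : ℂ → Fin 2 → ℂ, IsHillPair V ρ w →
      (∃ Φ : (SL(2, ℂ) ⧸ subgroupSU2) ≃ liouvilleSolutions V ρ,
        ∀ (B : SL(2, ℂ)) (z : V),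
          (Φ (QuotientGroup.mk B) : V → ℝ) z = hillPotential (hillTransform B⁻¹ w) z) ∧
      (∀ z₀ ∈ V, ∃ Ψ : (SL(2, ℂ) ⧸ subgroupSU2) ≃ₜ ℝ × ℂ,
        ∀ B : SL(2, ℂ), Ψ (QuotientGroup.mk B) =
          (hillPotential (hillTransform B⁻¹ w) z₀,
            wirtingerZ (fun p => (hillPotential (hillTransform B⁻¹ w) p : ℂ)) z₀))) ∧
    -- the associated minimal immersions
    (∀ w : ℂ → Fin 2 → ℂ, IsHillPair V ρ w →
      ∃ X : ℂ → EuclideanSpace ℝ (Fin 3), IsMinimalImmersion V X ∧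
        ∀ z ∈ V,
          firstFundamentalForm X z = (hillNormSq w z) ^ 2 • dzNormSq ∧
          secondFundamentalForm X z = dzSq.map Complex.re ∧
          hopfDifferential X z = dzSq ∧
          gaussCurvature (firstFundamentalForm X) z < 0 ∧
          entropyDifferential (firstFundamentalForm X) z = (ρ z / 2) • dzSq) := by
  have hV : IsConnected V := hVs.isPathConnected.isConnected
  obtain ⟨w₀, hw₀⟩ := exists_isHillPair hVo hVs hρ
  refine ⟨fun u => ⟨fun hu => ?_, ?_⟩, ⟨w₀, hw₀⟩, fun w hw =>
    ⟨hw.exists_equiv_liouvilleSolutions hVo hV, fun z₀ hz₀ => hw.exists_homeomorph hVo hz₀⟩,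
    fun w hw => ?_⟩
  · obtain ⟨B, hB⟩ := hw₀.exists_hillTransform hVo hV hu
    exact ⟨_, hw₀.transform hVo B⁻¹, hB⟩
  · rintro ⟨w, hw, h⟩
    exact (hw.isLiouvilleSolution hVo).congr hVo h
  · obtain ⟨X, hX, hXV⟩ := hw.exists_isMinimalImmersion hVo hVs
    have hg : ∀ p ∈ V, firstFundamentalForm X p = Real.exp (2 * hillPotential w p) • 1 := by
      intro p hp
      rw [(hXV p hp).1, two_mul, Real.exp_add, hillPotential, Real.exp_log (hw.hillNormSq_pos hp),
        sq]
    refine ⟨X, hX, fun z hz => ?_⟩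
    obtain ⟨hK, hP⟩ := (hw.isLiouvilleSolution hVo).entropyDifferential_eq hVo hg hz
    refine ⟨by rw [dzNormSq_eq_one]; exact (hXV z hz).1, (hXV z hz).2, ?_, hK, hP⟩
    rw [hopfDifferential, quadraticDifferential_of_eq_smul_one (Real.exp_pos _) (hg z hz),
      (hXV z hz).2]
    ext i j
    fin_cases i <;> fin_cases j <;> simp [dzSq, coordVec]
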